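/- \textbf{Corollary} (Characterization of definable functions $\Psi\to\Psi$). An \emph{$H$-asymptotic couple} is a pair $(\Gamma,\psi)$ where $\Gamma$ is a (totally) ordered abelian group and $\psi:\Gamma\setminus\{0\}\to\Gamma$ satisfies, for all nonzero $\alpha,\beta\in\Gamma$: (AC1) if $\alpha+\beta\neq 0$ then $\psi(\alpha+\beta)\ge\min(\psi(\alpha),\psi(\beta))$; (AC2) $\psi(r\alpha)=\psi(\alpha)$ for all nonzero $r\in\mathbb{Z}$; (AC3) if $\alpha>0$ then $\alpha+\psi(\alpha)>\psi(\beta)$; (HC) if $0<\alpha\le\beta$ then $\psi(\alpha)\ge\psi(\beta)$. Put $\Psi:=\psi(\Gamma\setminus\{0\})$. The couple has \emph{asymptotic integration} if every $\alpha\in\Gamma$ equals $\beta+\psi(\beta)$ for some nonzero $\beta\in\Gamma$; this $\beta$ is then unique, it is denoted by $\int\alpha$, and one sets $s(\alpha):=\psi(\int\alpha)\in\Psi$, writing $s0$ for $s(0)$. Let $(\Gamma,\psi)$ be a model of $T_{\log}$, that is, an $H$-asymptotic couple with asymptotic integration such that $\Gamma$ is divisible, $\Psi$ has least element $s0>0$,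 each $\alpha\in\Psi$ has an immediate successor in $\Psi$ with respect to the ordering, namely $s(\alpha)$, and $s$ restricts to a bijection $\Psi\to\Psi^{>s0}:=\{\alpha\in\Psi:\alpha>s0\}$. Let $\Gamma_\infty:=\Gamma\cup\{\infty\}$ with $\Gamma<\infty$, and let $p:\Gamma_\infty\to\Gamma_\infty$ be the inverse of this bijection on $\Psi^{>s0}$ and take the value $\infty$ elsewhere. Regard $(\Gamma,\psi)$ as a structure with underlying set $\Gamma_\infty$ in the language $\{0,+,-,<,\psi,\infty,s,p,\delta_1,\delta_2,\dots\}$, where $\delta_n$ is division by $n$, where $+,-,s,\delta_n$ take the value $\infty$ as soon as an argument is $\infty$, and where $\psi(0)=\psi(\infty)=\infty$. ``Definable'' means definable in this structure with parameters from $\Gamma_\infty$; a function is definable if its graph is. For $l\ge 0$ let $s^l$ be the $l$-fold iterate of $s$, and for $l<0$ let $s^l:=p^{-l}$ be the $(-l)$-fold iterate of $p$. Put $\Psi_\infty:=\Psi\cup\{\infty\}$ and $[\alpha,\beta)_\Psi:=\{x\in\Psi:\alpha\le x<\beta\}$ for $\alpha,\beta\in\Psi_\infty$. Let $F:\Psi\to\Psi$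 be definable in $(\Gamma,\psi)$. Then there are $n\geq 1$ and a sequence $s0=\alpha_0<\alpha_1<\cdots<\alpha_{n-1}<\alpha_n=\infty$ in $\Psi_\infty$ such that for each $k=1,\dots,n$ the restriction of $F$ to $[\alpha_{k-1},\alpha_k)_\Psi$ is either constant or of the form $x\mapsto s^l(x)$ for some $l\in\mathbb{Z}$. -/

import Mathlib

/-- An asymptotic couple with underlying ordered abelian group `Γ`:
a map `ψ : Γ \ {0} → Γ` satisfying (AC1), (AC2), (AC3). -/
structure AsymptoticCouple (Γ : Type*) [AddCommGroup Γ] [LinearOrder Γ]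
    [IsOrderedAddMonoid Γ] where
  psi : {γ : Γ // γ ≠ 0} → Γ
  ac1 : ∀ (α β : {γ : Γ // γ ≠ 0}) (h : (α : Γ) + (β : Γ) ≠ 0),
    min (psi α) (psi β) ≤ psi ⟨(α : Γ) + (β : Γ), h⟩
  ac2 : ∀ (α : {γ : Γ // γ ≠ 0}) (r : ℤ) (h : r • (α : Γ) ≠ 0),
    psi ⟨r • (α : Γ), h⟩ = psi α
  ac3 : ∀ α β : {γ : Γ // γ ≠ 0}, 0 < (α : Γ) → psi β < (α : Γ) + psi α

namespace AsymptoticCouple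

variable {Γ : Type*} [AddCommGroup Γ] [LinearOrder Γ] [IsOrderedAddMonoid Γ]

/-- `Ψ = ψ(Γ \ {0})`. -/
def Psi (A : AsymptoticCouple Γ) : Set Γ := Set.range A.psi

/-- The map `γ ↦ γ' = γ + ψ(γ)` on nonzero elements. -/
def der (A : AsymptoticCouple Γ) (γ : {γ : Γ // γ ≠ 0}) : Γ := (γ : Γ) + A.psi γ

/-- Being of `H`-type, that is, condition (HC). -/
def IsHType (A : AsymptoticCouple Γ) : Prop :=
  ∀ α β : {γ : Γ // γ ≠ 0}, 0 < (α : Γ) → (α : Γ) ≤ (β : Γ) → A.psi β ≤ A.psi α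

/-- Divisibility of the underlying group. -/
def IsDivisible (_A : AsymptoticCouple Γ) : Prop :=
  ∀ (n : ℕ+) (γ : Γ), ∃ β : Γ, (n : ℕ) • β = γ

/-- Asymptotic integration: `Γ = (Γ \ {0})'`. -/
def HasAsymptoticIntegration (A : AsymptoticCouple Γ) : Prop :=
  ∀ α : Γ, ∃ β : {γ : Γ // γ ≠ 0}, A.der β = α

/-- The map `γ ↦ γ'` is injective, so that integrals are unique. -/
theorem der_injective (A : AsymptoticCouple Γ) : Function.Injective A.der := by
  have key : ∀ a b : {γ : Γ // γ ≠ 0}, A.der a = A.der b → ¬ (b : Γ) < (a : Γ) := by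
    intro a b hab hlt
    have hd : (a : Γ) - (b : Γ) ≠ 0 := sub_ne_zero.2 hlt.ne'
    have hpos : 0 < (a : Γ) - (b : Γ) := sub_pos.2 hlt
    have e : (a : Γ) + A.psi a = (b : Γ) + A.psi b := hab
    have e' : (a : Γ) - (b : Γ) = A.psi b - A.psi a := by
      rw [sub_eq_sub_iff_add_eq_add, e, add_comm]
    have hψ : A.psi a < A.psi b := by rw [e'] at hpos; exact sub_pos.1 hpos
    have h3 := A.ac3 ⟨(a : Γ) - (b : Γ), hd⟩ b hpos
    have h1 := A.ac1 ⟨(a : Γ) - (b : Γ), hd⟩ b (by simpa using a.2)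
    have hs : (⟨((a : Γ) - (b : Γ)) + (b : Γ), by simpa using a.2⟩ : {γ : Γ // γ ≠ 0}) = a :=
      Subtype.ext (by simp)
    rw [hs] at h1
    have h4 : A.psi ⟨(a : Γ) - (b : Γ), hd⟩ ≤ A.psi a := by
      rcases min_le_iff.1 h1 with h | h
      · exact h
      · exact absurd h (not_le.2 hψ)
    have h5 : ((a : Γ) - (b : Γ)) + A.psi ⟨(a : Γ) - (b : Γ), hd⟩ ≤ A.psi b := by
      calc ((a : Γ) - (b : Γ)) + A.psi ⟨(a : Γ) - (b : Γ), hd⟩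
          ≤ (A.psi b - A.psi a) + A.psi a := add_le_add e'.le h4
        _ = A.psi b := by simp
    exact absurd h3 (not_lt.2 h5)
  intro a b hab
  exact Subtype.ext (le_antisymm (not_lt.1 (key a b hab)) (not_lt.1 (key b a hab.symm)))

/-- `∫ α`, the unique nonzero `β` with `β' = α`. -/
noncomputable def integral (A : AsymptoticCouple Γ) (h : A.HasAsymptoticIntegration) (α : Γ) :
    {γ : Γ // γ ≠ 0} :=
  (h α).choose

/-- The successor function `s(α) = ψ(∫ α)`. -/
noncomputable def succ (A : AsymptoticCouple Γ) (h : A.HasAsymptoticIntegration) (α : Γ) : Γ :=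
  A.psi (A.integral h α)

/-- `(Γ, ψ)` is a model of `T_log`. -/
structure IsTlogModel (A : AsymptoticCouple Γ) : Prop where
  divisible : A.IsDivisible
  htype : A.IsHType
  integration : A.HasAsymptoticIntegration
  psi_least : IsLeast A.Psi (A.succ integration 0)
  succ_zero_pos : 0 < A.succ integration 0
  immediate_succ : ∀ α ∈ A.Psi, A.succ integration α ∈ A.Psi ∧ α < A.succ integration α ∧
    ∀ β ∈ A.Psi, α < β → A.succ integration α ≤ β
  succ_bijOn : Set.BijOn (A.succ integration) A.Psi {β | β ∈ A.Psi ∧ A.succ integration 0 < β}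

end AsymptoticCouple

/-- Function symbols of the language `L = {0, +, -, <, ψ, ∞, s, p, δ₁, δ₂, …}`. -/
inductive TlogFunc : ℕ → Type
  | zero : TlogFunc 0
  | infty : TlogFunc 0
  | add : TlogFunc 2
  | neg : TlogFunc 1
  | psi : TlogFunc 1
  | s : TlogFunc 1
  | p : TlogFunc 1
  | delta (n : ℕ+) : TlogFunc 1

/-- Relation symbols of `L`. -/
inductive TlogRel : ℕ → Type
  | lt : TlogRel 2

/-- The language `L` of `T_log`. -/
def Llog : FirstOrder.Language := ⟨TlogFunc, TlogRel⟩

namespace AsymptoticCouple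

variable {Γ : Type*} [AddCommGroup Γ] [LinearOrder Γ] [IsOrderedAddMonoid Γ]

open Classical in
/-- `ψ` on `Γ_∞ = Γ ∪ {∞}`, with `ψ(0) = ψ(∞) = ∞`. -/
noncomputable def psiTop (A : AsymptoticCouple Γ) : WithTop Γ → WithTop Γ
  | ⊤ => ⊤
  | (γ : Γ) => if h : γ ≠ 0 then (A.psi ⟨γ, h⟩ : WithTop Γ) else ⊤

/-- `s` on `Γ_∞`, with `s(∞) = ∞`. -/
noncomputable def sTop (A : AsymptoticCouple Γ) (hA : A.IsTlogModel) : WithTop Γ → WithTop Γ :=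
  WithTop.map (A.succ hA.integration)

theorem exists_pred (A : AsymptoticCouple Γ) (hA : A.IsTlogModel) {γ : Γ}
    (h : γ ∈ A.Psi ∧ A.succ hA.integration 0 < γ) :
    ∃ β : Γ, β ∈ A.Psi ∧ A.succ hA.integration β = γ :=
  hA.succ_bijOn.surjOn h

open Classical in
/-- `p` on `Γ_∞`: on `Ψ^{> s0}` the inverse of the bijection `s : Ψ → Ψ^{> s0}`, and `∞`
elsewhere. -/
noncomputable def pTop (A : AsymptoticCouple Γ) (hA : A.IsTlogModel) : WithTop Γ → WithTop Γ
  | ⊤ => ⊤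
  | (γ : Γ) =>
    if h : γ ∈ A.Psi ∧ A.succ hA.integration 0 < γ then
      ((A.exists_pred hA h).choose : WithTop Γ)
    else ⊤

/-- `δₙ` on `Γ_∞`: division by `n`, with `δₙ(∞) = ∞`. -/
noncomputable def deltaTop (A : AsymptoticCouple Γ) (hA : A.IsTlogModel) (n : ℕ+) :
    WithTop Γ → WithTop Γ :=
  WithTop.map fun γ => (hA.divisible n γ).choose

/-- A model of `T_log` as an `L`-structure with underlying set `Γ_∞`. -/
@[reducible]
noncomputable def llogStructure (A : AsymptoticCouple Γ) (hA : A.IsTlogModel) :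
    Llog.Structure (WithTop Γ) where
  funMap := fun {_} f =>
    match f with
    | TlogFunc.zero => fun _ => 0
    | TlogFunc.infty => fun _ => ⊤
    | TlogFunc.add => fun v => v 0 + v 1
    | TlogFunc.neg => fun v => WithTop.map (fun γ : Γ => -γ) (v 0)
    | TlogFunc.psi => fun v => A.psiTop (v 0)
    | TlogFunc.s => fun v => A.sTop hA (v 0)
    | TlogFunc.p => fun v => A.pTop hA (v 0)
    | TlogFunc.delta n => fun v => A.deltaTop hA n (v 0)
  RelMap := fun {_} r =>
    match r with
    | TlogRel.lt => fun v => v 0 < v 1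

/-- `F : Ψ → Ψ` is definable: its graph, as a subset of `(Γ_∞)²`, is definable with parameters
in the `L`-structure `(Γ, ψ)`. -/
def IsDefinableFun (A : AsymptoticCouple Γ) (hA : A.IsTlogModel) (F : A.Psi → A.Psi) : Prop :=
  letI := A.llogStructure hA
  (Set.univ : Set (WithTop Γ)).Definable Llog
    {v : Fin 2 → WithTop Γ | ∃ x : A.Psi, v 0 = ((x : Γ) : WithTop Γ) ∧
      v 1 = ((F x : Γ) : WithTop Γ)}

/-- `Ψ_∞ = Ψ ∪ {∞}` as a subset of `Γ_∞`. -/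
def PsiTop (A : AsymptoticCouple Γ) : Set (WithTop Γ) :=
  insert ⊤ ((fun γ : Γ => (γ : WithTop Γ)) '' A.Psi)

/-- `s^l` for `l ∈ ℤ`, where `s^{-k} = p^k` for `k > 0`. -/
noncomputable def sPow (A : AsymptoticCouple Γ) (hA : A.IsTlogModel) :
    ℤ → WithTop Γ → WithTop Γ
  | Int.ofNat k => (A.sTop hA)^[k]
  | Int.negSucc k => (A.pTop hA)^[k + 1]

end AsymptoticCouple

/-! The argument is a back-and-forth in an ultrapower, followed by compactness. A divisible `Γ` is a
vector space over `ℚ`, and `psi` acts on it as a convex valuation for which `α - β` has value `s α`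
whenever `α < β` in `Ψ`. A partial isomorphism is represented by its graph, a `ℚ`-subspace of the
square (`LogOps.IsPIso`).

In an ultrapower along a nonprincipal ultrafilter on `ℕ`, a countable partial isomorphism extends to
any further element (`IsPIso.exists_extension`). A new member of `Ψ` is adjoined together with its
whole `s`-orbit and matched with an orbit in the corresponding cut (`IsNewOrbit.isPIso_adjoin`); the
decisive fact is that this adds to `Ψ` nothing but the orbit (`IsNewOrbit.mem_or_eq`). An element
that brings no new member of `Ψ` is matched by prescribing countably many values and signs
(`IsPIso.exists_adjoin`). Consequently formulas are preserved (`eventually_realize_iff`).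

Let `F` be definable over a countable closed `D`, and let `x` be a point of `Ψ` in the ultrapower
outside `D`. If `F x` were not in the subspace generated by `D` and the orbit of `x`, then `F x` and
`s (F x)` would fill the same cut over it, and some partial isomorphism would fix `D` and `x` while
moving `F x` to `s (F x)`. Hence `F x` is in `D` or is some `s^l x`
(`exists_eventually_eq_pieceVal`). All points in the cut of `x` over `D` look alike, so the same
description holds on an interval around `x` with ends in `D` (`not_eventually_eq_pieceVal`). By
saturation finitely many such intervals cover `Ψ` (`exists_finite_pieces`), and their ends give the
required sequence. -/

/-- The operations of a model of `T_log`, as total functions on a `ℚ`-vector space. -/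
structure LogOps (Γ : Type*) [AddCommGroup Γ] [LinearOrder Γ] [IsOrderedAddMonoid Γ]
    [Module ℚ Γ] where
  psi : Γ → Γ
  s : Γ → Γ
  p : Γ → Γ
  w : Γ → Γ
  P : Set Γ
  psi_add : ∀ a b, a ≠ 0 → b ≠ 0 → a + b ≠ 0 → min (psi a) (psi b) ≤ psi (a + b)
  psi_smul : ∀ (q : ℚ) a, q ≠ 0 → a ≠ 0 → psi (q • a) = psi a
  psi_lt : ∀ a b, 0 < a → b ≠ 0 → psi b < a + psi a
  psi_anti : ∀ a b, 0 < a → a ≤ b → psi b ≤ psi a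
  s_spec : ∀ a, a ≠ s a ∧ psi (a - s a) = s a
  s_unique : ∀ a c, a ≠ c → psi (a - c) = c → s a = c
  psi_mem : ∀ a, a ≠ 0 → psi a ∈ P
  w_spec : ∀ c, c ∈ P → 0 < w c ∧ psi (w c) = c
  s_zero_le : ∀ c, c ∈ P → s 0 ≤ c
  lt_s : ∀ c, c ∈ P → c < s c
  s_le : ∀ c d, c ∈ P → d ∈ P → c < d → s c ≤ d
  p_spec : ∀ c, c ∈ P → s 0 < c → p c ∈ P ∧ s (p c) = c

/-! ### Signs of rational multiples and the valuation attached to `psi`. -/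

section Rat

variable {Γ : Type*} [AddCommGroup Γ] [LinearOrder Γ] [IsOrderedAddMonoid Γ] [Module ℚ Γ]

/-- No compatibility between the order and the `ℚ`-action is assumed; multiplying by the denominator
reduces the claim to natural multiples, where it is automatic. -/
theorem rat_smul_pos {q : ℚ} {a : Γ} (hq : 0 < q) (ha : 0 < a) : 0 < q • a := by
  by_contra h
  have h1 : q.den • (q • a) ≤ 0 := nsmul_nonpos (not_lt.1 h) _
  have h2 : q.den • (q • a) = q.num.toNat • a := by
    rw [← Nat.cast_smul_eq_nsmul ℚ, ← Nat.cast_smul_eq_nsmul ℚ, smul_smul]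
    congr 1
    have : ((q.num.toNat : ℤ) : ℚ) = (q.num : ℚ) := by
      rw [Int.toNat_of_nonneg (Rat.num_nonneg.2 hq.le)]
    rw [← Int.cast_natCast (q.num.toNat), this, mul_comm, Rat.mul_den_eq_num]
  rw [h2] at h1
  have : q.num.toNat ≠ 0 := by
    have := Rat.num_pos.2 hq
    omega
  exact absurd (nsmul_pos ha this) (not_lt.2 h1)

theorem rat_smul_pos_iff {q : ℚ} {a : Γ} (hq : 0 < q) : 0 < q • a ↔ 0 < a := by
  refine ⟨fun h => ?_, rat_smul_pos hq⟩
  have := rat_smul_pos (inv_pos.2 hq) h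
  rwa [smul_smul, inv_mul_cancel₀ hq.ne', one_smul] at this

theorem rat_smul_pos_iff_of_neg {q : ℚ} {a : Γ} (hq : q < 0) : 0 < q • a ↔ a < 0 := by
  have := rat_smul_pos_iff (a := -a) (neg_pos.2 hq)
  rwa [neg_smul_neg, neg_pos] at this

end Rat

namespace LogOps

variable {Γ : Type*} [AddCommGroup Γ] [LinearOrder Γ] [IsOrderedAddMonoid Γ] [Module ℚ Γ]
  (O : LogOps Γ)

open Classical in
/-- The valuation associated with `psi`, with value `⊤` at `0`. -/
noncomputable def v (a : Γ) : WithTop Γ := if a = 0 then ⊤ else (O.psi a : WithTop Γ)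

@[simp] theorem v_zero : O.v 0 = ⊤ := by simp [v]

theorem v_of_ne {a : Γ} (h : a ≠ 0) : O.v a = O.psi a := by simp [v, h]

theorem v_eq_coe {a c : Γ} : O.v a = c ↔ a ≠ 0 ∧ O.psi a = c := by
  by_cases h : a = 0 <;> simp [v, h]

theorem v_smul {q : ℚ} (hq : q ≠ 0) (a : Γ) : O.v (q • a) = O.v a := by
  by_cases h : a = 0
  · simp [h]
  · rw [O.v_of_ne h, O.v_of_ne (smul_ne_zero hq h), O.psi_smul q a hq h]

@[simp] theorem v_neg (a : Γ) : O.v (-a) = O.v a := by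
  have := O.v_smul (q := -1) (by norm_num) a
  rwa [neg_smul, one_smul] at this

theorem v_sub_comm (a b : Γ) : O.v (a - b) = O.v (b - a) := by
  rw [← O.v_neg, neg_sub]

theorem le_v_add {c : WithTop Γ} {a b : Γ} (ha : c ≤ O.v a) (hb : c ≤ O.v b) :
    c ≤ O.v (a + b) := by
  by_cases h1 : a = 0
  · simpa [h1] using hb
  by_cases h2 : b = 0
  · simpa [h2] using ha
  by_cases h3 : a + b = 0
  · simp [h3]
  rw [O.v_of_ne h1] at ha
  rw [O.v_of_ne h2] at hb
  rw [O.v_of_ne h3]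
  have := O.psi_add a b h1 h2 h3
  refine (le_min ha hb).trans ?_
  rw [← WithTop.coe_min]
  exact_mod_cast this

theorem lt_v_add {c : WithTop Γ} {a b : Γ} (ha : c < O.v a) (hb : c < O.v b) :
    c < O.v (a + b) :=
  lt_of_lt_of_le (lt_min ha hb) (O.le_v_add (min_le_left _ _) (min_le_right _ _))

theorem v_add_eq {a b : Γ} (h : O.v a < O.v b) : O.v (a + b) = O.v a := by
  refine le_antisymm ?_ (O.le_v_add le_rfl h.le)
  by_contra h1
  have := O.lt_v_add (not_le.1 h1) (b := -b) (by rwa [v_neg])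
  simp at this

theorem v_anti {a b : Γ} (ha : 0 < a) (hab : a ≤ b) : O.v b ≤ O.v a := by
  rw [O.v_of_ne ha.ne', O.v_of_ne (ha.trans_le hab).ne']
  exact_mod_cast O.psi_anti a b ha hab

/-- Otherwise `0 < a ≤ -b`, and antitonicity on positive elements would give `v b ≤ v a`. -/
theorem add_pos_of_v_lt {a b : Γ} (h : O.v a < O.v b) (ha : 0 < a) : 0 < a + b := by
  by_contra h1
  have : a ≤ -b := by rwa [← sub_nonpos, sub_neg_eq_add, ← not_lt]
  have := O.v_anti ha this
  rw [v_neg] at this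
  exact absurd h (not_lt.2 this)

theorem add_pos_iff {a b : Γ} (h : O.v a < O.v b) : 0 < a + b ↔ 0 < a := by
  refine ⟨fun h1 => ?_, O.add_pos_of_v_lt h⟩
  by_contra h2
  have ha : a ≠ 0 := by rintro rfl; simp at h
  have h3 := O.add_pos_of_v_lt (a := -a) (b := -b) (by simpa using h)
    (neg_pos.2 (lt_of_le_of_ne (not_lt.1 h2) ha))
  rw [← neg_add, neg_pos] at h3
  exact lt_asymm h1 h3

theorem v_sub_s (a : Γ) : O.v (a - O.s a) = O.s a :=
  O.v_eq_coe.2 ⟨sub_ne_zero.2 (O.s_spec a).1, (O.s_spec a).2⟩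

theorem s_eq {a c : Γ} (h : O.v (a - c) = c) : O.s a = c := by
  obtain ⟨h1, h2⟩ := O.v_eq_coe.1 h
  exact O.s_unique a c (sub_ne_zero.1 h1) h2

theorem s_mem (a : Γ) : O.s a ∈ O.P := by
  rw [← (O.s_spec a).2]
  exact O.psi_mem _ (sub_ne_zero.2 (O.s_spec a).1)

/-- This is (AC3) for `b - a` against an element whose `psi`-value is `b`: it gives `b < (b - a) +
psi (b - a)`. -/
theorem lt_v_sub_of_mem {a b : Γ} (hb : b ∈ O.P) (hab : a < b) :
    (a : WithTop Γ) < O.v (b - a) := by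
  have hd : 0 < b - a := sub_pos.2 hab
  have := O.psi_lt (b - a) (O.w b) hd (O.w_spec b hb).1.ne'
  rw [(O.w_spec b hb).2] at this
  rw [O.v_of_ne hd.ne']
  have h2 : a < O.psi (b - a) := by
    have h3 : b < b + (O.psi (b - a) - a) := by convert this using 1; abel
    exact sub_pos.1 (pos_of_lt_add_right h3)
  exact_mod_cast h2

theorem v_sub_of_s_lt {a b : Γ} (h : O.s a < O.s b) : O.v (b - a) = O.s a := by
  -- The term `a - s a` dominates: `b - s b` has value `s b`, and `s b - s a` has value above `s a`
  -- by `lt_v_sub_of_mem`.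
  have h1 : b - a = -(a - O.s a) + ((b - O.s b) + (O.s b - O.s a)) := by abel
  have h2 : O.v (-(a - O.s a)) = O.s a := by rw [v_neg, v_sub_s]
  rw [h1, O.v_add_eq, h2]
  rw [h2]
  refine O.lt_v_add ?_ (O.lt_v_sub_of_mem (O.s_mem b) h)
  rw [v_sub_s]
  exact_mod_cast h

theorem v_sub_of_s_lt' {a b : Γ} (h : O.s a < O.s b) : O.v (a - b) = O.s a := by
  rw [v_sub_comm, O.v_sub_of_s_lt h]

theorem s_lt_s {a b : Γ} (ha : a ∈ O.P) (hb : b ∈ O.P) (h : a < b) : O.s a < O.s b :=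
  (O.s_le a b ha hb h).trans_lt (O.lt_s b hb)

theorem s_inj {a b : Γ} (ha : a ∈ O.P) (hb : b ∈ O.P) (h : O.s a = O.s b) : a = b := by
  rcases lt_trichotomy a b with h1 | h1 | h1
  · exact absurd h (O.s_lt_s ha hb h1).ne
  · exact h1
  · exact absurd h (O.s_lt_s hb ha h1).ne'

theorem s_zero_lt_s {a : Γ} (ha : a ∈ O.P) : O.s 0 < O.s a :=
  (O.s_zero_le a ha).trans_lt (O.lt_s a ha)

theorem v_sub_of_mem {a b : Γ} (ha : a ∈ O.P) (hb : b ∈ O.P) (h : a < b) :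
    O.v (a - b) = O.s a :=
  O.v_sub_of_s_lt' (O.s_lt_s ha hb h)

end LogOps

/-! ### Partial isomorphisms as graphs. -/

section Swap

variable {Γ : Type*} [AddCommGroup Γ] [Module ℚ Γ]

theorem mem_map_prodComm {G : Submodule ℚ (Γ × Γ)} {z : Γ × Γ} :
    z ∈ G.map (LinearEquiv.prodComm ℚ Γ Γ).toLinearMap ↔ z.swap ∈ G := by
  constructor
  · rintro ⟨y, hy, rfl⟩
    simpa using hy
  · intro h
    exact ⟨z.swap, h, by simp⟩

end Swap

namespace LogOps

variable {Γ : Type*} [AddCommGroup Γ] [LinearOrder Γ] [IsOrderedAddMonoid Γ] [Module ℚ Γ]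
  (O : LogOps Γ)

/-- Both components of `z` have the values given by `c`, and they have the same sign. -/
structure Lead (z c : Γ × Γ) : Prop where
  fst : O.v z.1 = c.1
  snd : O.v z.2 = c.2
  pos : 0 < z.1 ↔ 0 < z.2

/-- Both components of `z` have values larger than those given by `c`. -/
def Small (z c : Γ × Γ) : Prop := (c.1 : WithTop Γ) < O.v z.1 ∧ (c.2 : WithTop Γ) < O.v z.2

variable {O}

theorem Lead.ne_fst {z c : Γ × Γ} (h : O.Lead z c) : z.1 ≠ 0 := (O.v_eq_coe.1 h.fst).1
theorem Lead.ne_snd {z c : Γ × Γ} (h : O.Lead z c) : z.2 ≠ 0 := (O.v_eq_coe.1 h.snd).1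
theorem Lead.psi_fst {z c : Γ × Γ} (h : O.Lead z c) : O.psi z.1 = c.1 := (O.v_eq_coe.1 h.fst).2
theorem Lead.psi_snd {z c : Γ × Γ} (h : O.Lead z c) : O.psi z.2 = c.2 := (O.v_eq_coe.1 h.snd).2

theorem Small.add {z y c : Γ × Γ} (hz : O.Small z c) (hy : O.Small y c) : O.Small (z + y) c :=
  ⟨O.lt_v_add hz.1 hy.1, O.lt_v_add hz.2 hy.2⟩

theorem small_zero (c : Γ × Γ) : O.Small 0 c := by simp [Small]

theorem Small.smul {z c : Γ × Γ} (hz : O.Small z c) (q : ℚ) : O.Small (q • z) c := by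
  by_cases hq : q = 0
  · rw [hq, zero_smul]; exact small_zero c
  · refine ⟨?_, ?_⟩
    · rw [Prod.smul_fst, O.v_smul hq]; exact hz.1
    · rw [Prod.smul_snd, O.v_smul hq]; exact hz.2

theorem Lead.smul {z c : Γ × Γ} (hz : O.Lead z c) {q : ℚ} (hq : q ≠ 0) : O.Lead (q • z) c := by
  refine ⟨?_, ?_, ?_⟩
  · rw [Prod.smul_fst, O.v_smul hq, hz.fst]
  · rw [Prod.smul_snd, O.v_smul hq, hz.snd]
  · rw [Prod.smul_fst, Prod.smul_snd]
    rcases lt_or_gt_of_ne hq with h | h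
    · rw [rat_smul_pos_iff_of_neg h, rat_smul_pos_iff_of_neg h]
      have h1 := hz.ne_fst
      have h2 := hz.ne_snd
      have := hz.pos
      rw [← not_le, ← not_le, le_iff_lt_or_eq, le_iff_lt_or_eq, this]
      simp [h1.symm, h2.symm]
    · rw [rat_smul_pos_iff h, rat_smul_pos_iff h, hz.pos]

theorem Lead.neg {z c : Γ × Γ} (hz : O.Lead z c) : O.Lead (-z) c := by
  simpa using hz.smul (q := -1) (by norm_num)

/-- Each component keeps the value and the sign of its dominant term. -/
theorem Lead.add_small {z y c : Γ × Γ} (hz : O.Lead z c) (hy : O.Small y c) :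
    O.Lead (z + y) c := by
  have h1 : O.v z.1 < O.v y.1 := by rw [hz.fst]; exact hy.1
  have h2 : O.v z.2 < O.v y.2 := by rw [hz.snd]; exact hy.2
  refine ⟨?_, ?_, ?_⟩
  · rw [Prod.fst_add, O.v_add_eq h1, hz.fst]
  · rw [Prod.snd_add, O.v_add_eq h2, hz.snd]
  · rw [Prod.fst_add, Prod.snd_add, O.add_pos_iff h1, O.add_pos_iff h2, hz.pos]

theorem Lead.small_add {z y c : Γ × Γ} (hz : O.Lead z c) (hy : O.Small y c) :
    O.Lead (y + z) c := add_comm z y ▸ hz.add_small hy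

theorem Lead.small {z c d : Γ × Γ} (hz : O.Lead z c) (h1 : d.1 < c.1) (h2 : d.2 < c.2) :
    O.Small z d := by
  refine ⟨?_, ?_⟩
  · rw [hz.fst]; exact_mod_cast h1
  · rw [hz.snd]; exact_mod_cast h2

theorem Lead.swap {z c : Γ × Γ} (hz : O.Lead z c) : O.Lead z.swap c.swap :=
  ⟨hz.snd, hz.fst, hz.pos.symm⟩

theorem Lead.s_fst {z c : Γ × Γ} (h : O.Lead (z - c) c) : O.s z.1 = c.1 := O.s_eq h.fst
theorem Lead.s_snd {z c : Γ × Γ} (h : O.Lead (z - c) c) : O.s z.2 = c.2 := O.s_eq h.snd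

variable (O)

/-- `G` is the graph of an isomorphism between `ℚ`-subspaces closed under all operations. -/
structure IsPIso (G : Submodule ℚ (Γ × Γ)) : Prop where
  lead : ∀ z ∈ G, z ≠ 0 → ∃ c ∈ G, O.Lead z c
  lead_sub : ∀ z ∈ G, ∃ c ∈ G, O.Lead (z - c) c
  mem_P : ∀ z ∈ G, z.1 ∈ O.P ↔ z.2 ∈ O.P
  pred : ∀ z ∈ G, z.1 ∈ O.P → O.s 0 < z.1 → (O.p z.1, O.p z.2) ∈ G

namespace IsPIso

variable {O} {G : Submodule ℚ (Γ × Γ)} (hG : O.IsPIso G)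
include hG

theorem pos {z : Γ × Γ} (hz : z ∈ G) : 0 < z.1 ↔ 0 < z.2 := by
  by_cases h : z = 0
  · simp [h]
  · obtain ⟨c, -, hc⟩ := hG.lead z hz h
    exact hc.pos

theorem eq_zero_iff {z : Γ × Γ} (hz : z ∈ G) : z.1 = 0 ↔ z.2 = 0 := by
  by_cases h : z = 0
  · simp [h]
  · obtain ⟨c, -, hc⟩ := hG.lead z hz h
    simp [hc.ne_fst, hc.ne_snd]

theorem eq_zero_of_fst {z : Γ × Γ} (hz : z ∈ G) (h : z.1 = 0) : z = 0 :=
  Prod.ext h ((hG.eq_zero_iff hz).1 h)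

theorem lt_iff {z y : Γ × Γ} (hz : z ∈ G) (hy : y ∈ G) : z.1 < y.1 ↔ z.2 < y.2 := by
  simpa using hG.pos (G.sub_mem hy hz)

theorem eq_of_fst {z y : Γ × Γ} (hz : z ∈ G) (hy : y ∈ G) (h : z.1 = y.1) : z = y :=
  sub_eq_zero.1 (hG.eq_zero_of_fst (G.sub_mem hz hy) (by simp [h]))

theorem psi_mem {z : Γ × Γ} (hz : z ∈ G) (h : z ≠ 0) : (O.psi z.1, O.psi z.2) ∈ G := by
  obtain ⟨c, h1, hc⟩ := hG.lead z hz h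
  rwa [hc.psi_fst, hc.psi_snd]

theorem lead_psi {z : Γ × Γ} (hz : z ∈ G) (h : z ≠ 0) : O.Lead z (O.psi z.1, O.psi z.2) := by
  obtain ⟨c, h1, hc⟩ := hG.lead z hz h
  rwa [hc.psi_fst, hc.psi_snd]

theorem s_mem {z : Γ × Γ} (hz : z ∈ G) : (O.s z.1, O.s z.2) ∈ G := by
  obtain ⟨c, h1, hc⟩ := hG.lead_sub z hz
  rwa [hc.s_fst, hc.s_snd]

theorem lead_sub_s {z : Γ × Γ} (hz : z ∈ G) :
    O.Lead (z - (O.s z.1, O.s z.2)) (O.s z.1, O.s z.2) := by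
  obtain ⟨c, h1, hc⟩ := hG.lead_sub z hz
  rwa [hc.s_fst, hc.s_snd]

theorem s_zero_mem : (O.s 0, O.s 0) ∈ G := hG.s_mem G.zero_mem

/-- The domain is closed under predecessors in `Ψ`. -/
theorem mem_of_s_eq_fst {c : Γ × Γ} (hc : c ∈ G) {a : Γ} (ha : a ∈ O.P) (h : O.s a = c.1) :
    ∃ b, b ∈ O.P ∧ O.s b = c.2 ∧ (a, b) ∈ G := by
  have h1 : c.1 ∈ O.P := h ▸ O.s_mem a
  have h2 : O.s 0 < c.1 := h ▸ O.s_zero_lt_s ha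
  have h3 : O.s 0 < c.2 := (hG.lt_iff hG.s_zero_mem hc).1 h2
  have h4 := O.p_spec c.1 h1 h2
  have h5 := O.p_spec c.2 ((hG.mem_P c hc).1 h1) h3
  have h6 : O.p c.1 = a := O.s_inj h4.1 ha (h4.2.trans h.symm)
  exact ⟨O.p c.2, h5.1, h5.2, h6 ▸ hG.pred c hc h1 h2⟩

/-- The inverse of a partial isomorphism is one; this supplies the "back" half of every one-sided
argument. -/
theorem symm : O.IsPIso (G.map (LinearEquiv.prodComm ℚ Γ Γ).toLinearMap) := by
  refine ⟨?_, ?_, ?_, ?_⟩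
  · intro z hz h0
    obtain ⟨c, h1, h2⟩ := hG.lead z.swap (mem_map_prodComm.1 hz)
      (fun h => h0 (Prod.swap_injective h))
    exact ⟨c.swap, mem_map_prodComm.2 (by simpa using h1), by simpa using h2.swap⟩
  · intro z hz
    obtain ⟨c, h1, h2⟩ := hG.lead_sub z.swap (mem_map_prodComm.1 hz)
    exact ⟨c.swap, mem_map_prodComm.2 (by simpa using h1), h2.swap⟩
  · intro z hz
    exact (hG.mem_P _ (mem_map_prodComm.1 hz)).symm
  · intro z hz h1 h2
    have hz' := mem_map_prodComm.1 hz
    exact mem_map_prodComm.2 (hG.pred _ hz' ((hG.mem_P _ hz').2 h1)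
      ((hG.lt_iff hG.s_zero_mem hz').2 h2))

end IsPIso

end LogOps

/-! ### Adjoining a pair of `s`-orbits. -/

namespace LogOps

variable {Γ : Type*} [AddCommGroup Γ] [LinearOrder Γ] [IsOrderedAddMonoid Γ] [Module ℚ Γ]
  (O : LogOps Γ)

/-- `o` runs through a two-sided `s`-orbit in `Ψ`. -/
structure IsOrbit (o : ℤ → Γ) : Prop where
  mem : ∀ l, o l ∈ O.P
  s_eq : ∀ l, O.s (o l) = o (l + 1)

variable {O}

theorem IsOrbit.strictMono {o : ℤ → Γ} (h : O.IsOrbit o) : StrictMono o :=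
  strictMono_int_of_lt_succ fun l => h.s_eq l ▸ O.lt_s _ (h.mem l)

theorem IsOrbit.p_eq {o : ℤ → Γ} (h : O.IsOrbit o) (l : ℤ) : O.p (o l) = o (l - 1) := by
  have h4 : O.s (o (l - 1)) = o l := by rw [h.s_eq, sub_add_cancel]
  have h5 := O.p_spec (o l) (h.mem l) (h4 ▸ O.s_zero_lt_s (h.mem _))
  exact O.s_inj h5.1 (h.mem _) (h5.2.trans h4.symm)

theorem IsOrbit.v_sub {o : ℤ → Γ} (h : O.IsOrbit o) {i j : ℤ} (hij : i < j) :
    O.v (o i - o j) = o (i + 1) := by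
  rw [O.v_sub_of_mem (h.mem i) (h.mem j) (h.strictMono hij), h.s_eq]

/-- The steps of an orbit are immediate successors, so an element of `Ψ` off the orbit cannot slip
between two of its members. -/
theorem IsOrbit.lt_of_lt {o : ℤ → Γ} (h : O.IsOrbit o) {c : Γ} (hc : c ∈ O.P)
    (hn : ∀ l, c ≠ o l) (h0 : c < o 0) (l : ℤ) : c < o l := by
  induction l using Int.induction_on with
  | zero => exact h0
  | succ i ih => exact ih.trans (h.strictMono (by omega))
  | pred i ih =>
    by_contra h1
    have h2 := lt_of_le_of_ne (not_lt.1 h1) (hn _).symm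
    have h3 := O.s_le _ _ (h.mem _) hc h2
    rw [h.s_eq, sub_add_cancel] at h3
    exact absurd ih (not_lt.2 h3)

theorem IsOrbit.gt_of_gt {o : ℤ → Γ} (h : O.IsOrbit o) {c : Γ} (hc : c ∈ O.P)
    (hn : ∀ l, c ≠ o l) (h0 : o 0 < c) (l : ℤ) : o l < c := by
  induction l using Int.induction_on with
  | zero => exact h0
  | succ i ih =>
    have h3 := O.s_le _ _ (h.mem _) hc ih
    rw [h.s_eq] at h3
    exact lt_of_le_of_ne h3 (hn _).symm
  | pred i ih => exact (h.strictMono (by omega)).trans ih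

variable (O)

/-- `o` and `o'` are orbits outside of the domain and the range of `G` that correspond to the
same cut. -/
structure IsNewOrbit (G : Submodule ℚ (Γ × Γ)) (o o' : ℤ → Γ) : Prop where
  fst : O.IsOrbit o
  snd : O.IsOrbit o'
  ne_fst : ∀ z ∈ G, ∀ l, z.1 ≠ o l
  ne_snd : ∀ z ∈ G, ∀ l, z.2 ≠ o' l
  cut : ∀ z ∈ G, z.1 ∈ O.P → (z.1 < o 0 ↔ z.2 < o' 0)

/-- `G` extended by a pair of orbits. -/
def adjoinOrbit (G : Submodule ℚ (Γ × Γ)) (o o' : ℤ → Γ) : Submodule ℚ (Γ × Γ) :=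
  G ⊔ Submodule.span ℚ (Set.range fun l => (o l, o' l))

omit [LinearOrder Γ] [IsOrderedAddMonoid Γ] in
theorem le_adjoinOrbit (G : Submodule ℚ (Γ × Γ)) (o o' : ℤ → Γ) : G ≤ adjoinOrbit G o o' :=
  le_sup_left

omit [LinearOrder Γ] [IsOrderedAddMonoid Γ] in
theorem orbit_mem_adjoinOrbit (G : Submodule ℚ (Γ × Γ)) (o o' : ℤ → Γ) (l : ℤ) :
    (o l, o' l) ∈ adjoinOrbit G o o' :=
  Submodule.mem_sup_right (Submodule.subset_span ⟨l, rfl⟩)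

omit [LinearOrder Γ] [IsOrderedAddMonoid Γ] in
theorem mem_adjoinOrbit_of_mem_or_eq {G : Submodule ℚ (Γ × Γ)} {o o' : ℤ → Γ} {c : Γ × Γ}
    (hc : c ∈ G ∨ ∃ l, c = (o l, o' l)) : c ∈ adjoinOrbit G o o' := by
  rcases hc with hc | ⟨l, rfl⟩
  · exact le_adjoinOrbit G o o' hc
  · exact orbit_mem_adjoinOrbit G o o' l

variable {O}

theorem lead_orbit_sub {o o' : ℤ → Γ} (ho : O.IsOrbit o) (ho' : O.IsOrbit o') {i j : ℤ}
    (hij : i < j) : O.Lead ((o i, o' i) - (o j, o' j)) (o (i + 1), o' (i + 1)) := by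
  refine ⟨ho.v_sub hij, ho'.v_sub hij, ?_⟩
  have h1 := ho.strictMono hij
  have h2 := ho'.strictMono hij
  simp only [Prod.fst_sub, Prod.snd_sub, sub_pos]
  exact iff_of_false (not_lt.2 h1.le) (not_lt.2 h2.le)

theorem small_orbit_sub {o o' : ℤ → Γ} (ho : O.IsOrbit o) (ho' : O.IsOrbit o') {i j : ℤ}
    (hij : i ≤ j) : O.Small ((o j, o' j) - (o i, o' i)) (o i, o' i) := by
  rcases hij.eq_or_lt with rfl | h
  · rw [sub_self]; exact small_zero _
  · have := (lead_orbit_sub ho ho' h).neg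
    rw [neg_sub] at this
    exact this.small (ho.strictMono (by omega)) (ho'.strictMono (by omega))

/-- A nonzero combination of members of an orbit, relative to a late member of the orbit. -/
theorem exists_lead_of_mem_span {o o' : ℤ → Γ} (ho : O.IsOrbit o) (ho' : O.IsOrbit o')
    {t : Γ × Γ} (ht : t ∈ Submodule.span ℚ (Set.range fun l => (o l, o' l))) (h0 : t ≠ 0) :
    ∃ (Q : ℚ) (L k : ℤ) (r : Γ × Γ), k ≤ L ∧ t = Q • (o L, o' L) + r ∧
      O.Lead r (o k, o' k) := by
  obtain ⟨c, rfl⟩ := Finsupp.mem_span_range_iff_exists_finsupp.1 ht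
  have hne : c.support.Nonempty := by
    rw [Finsupp.support_nonempty_iff]
    rintro rfl
    simp at h0
  -- With `L` past the support, the sum is `(∑ cᵢ) o_L + ∑ cᵢ (o_i - o_L)`. The difference with
  -- index `i` has value `o (i + 1)`, so the smallest index `m` dominates and `k = m + 1`.
  set m := c.support.min' hne with hm
  have hmm : m ∈ c.support := Finset.min'_mem _ _
  have hmin : ∀ i ∈ c.support, m ≤ i := fun i hi => Finset.min'_le _ _ hi
  have hmax : ∀ i ∈ c.support, i < c.support.max' hne + 1 := fun i hi =>
    Int.lt_add_one_of_le (Finset.le_max' _ _ hi)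
  set L := c.support.max' hne + 1
  refine ⟨∑ i ∈ c.support, c i, L, m + 1,
    ∑ i ∈ c.support, c i • ((o i, o' i) - (o L, o' L)), hmax m hmm, ?_, ?_⟩
  · rw [Finset.sum_smul, ← Finset.sum_add_distrib, Finsupp.sum]
    refine Finset.sum_congr rfl fun i _ => ?_
    rw [smul_sub, add_sub_cancel]
  · rw [← Finset.add_sum_erase _ _ hmm]
    refine ((lead_orbit_sub ho ho' (hmax m hmm)).smul (Finsupp.mem_support_iff.1 hmm)).add_small ?_
    refine Finset.sum_induction _ (O.Small · _) (fun _ _ => Small.add) (small_zero _) ?_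
    intro i hi
    obtain ⟨h1, h2⟩ := Finset.mem_erase.1 hi
    have h3 : m < i := lt_of_le_of_ne (hmin i h2) h1.symm
    exact ((lead_orbit_sub ho ho' (hmax i h2)).small (ho.strictMono (by omega))
      (ho'.strictMono (by omega))).smul _

namespace IsNewOrbit

variable {G : Submodule ℚ (Γ × Γ)} {o o' : ℤ → Γ} (hG : O.IsPIso G) (h : O.IsNewOrbit G o o')
include hG h

theorem symm : O.IsNewOrbit (G.map (LinearEquiv.prodComm ℚ Γ Γ).toLinearMap) o' o where
  fst := h.snd
  snd := h.fst
  ne_fst z hz := h.ne_snd _ (mem_map_prodComm.1 hz)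
  ne_snd z hz := h.ne_fst _ (mem_map_prodComm.1 hz)
  cut z hz hP := by
    have hz' := mem_map_prodComm.1 hz
    exact (h.cut _ hz' ((hG.mem_P _ hz').2 hP)).symm

theorem lt_or_gt {c : Γ × Γ} (hc : c ∈ G) (hP : c.1 ∈ O.P) :
    (∀ l, c.1 < o l ∧ c.2 < o' l) ∨ ∀ l, o l < c.1 ∧ o' l < c.2 := by
  have hP' := (hG.mem_P c hc).1 hP
  rcases lt_or_gt_of_ne (h.ne_fst c hc 0) with h1 | h1
  · exact .inl fun l => ⟨h.fst.lt_of_lt hP (h.ne_fst c hc) h1 l,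
      h.snd.lt_of_lt hP' (h.ne_snd c hc) ((h.cut c hc hP).1 h1) l⟩
  · have h2 : o' 0 < c.2 := lt_of_le_of_ne
      (not_lt.1 fun h3 => lt_asymm h1 ((h.cut c hc hP).2 h3)) (h.ne_snd c hc 0).symm
    exact .inr fun l => ⟨h.fst.gt_of_gt hP (h.ne_fst c hc) h1 l,
      h.snd.gt_of_gt hP' (h.ne_snd c hc) h2 l⟩

omit hG in
theorem small_sub {d : Γ × Γ} {L : ℤ} (h1 : d.1 < o L) (h2 : d.2 < o' L) :
    O.Small ((o L, o' L) - d) d :=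
  ⟨O.lt_v_sub_of_mem (h.fst.mem L) h1, O.lt_v_sub_of_mem (h.snd.mem L) h2⟩

omit hG in
-- The difference of elements with distinct `s`-values has the smaller of these as its value; here
-- that is `o (L + 1)`, which is beyond `o k`.
theorem small_sub_of_gt {y : Γ × Γ} {L k : ℤ} (hk : k ≤ L)
    (h1 : ∀ l, o l < O.s y.1 ∧ o' l < O.s y.2) :
    O.Small (y - (o L, o' L)) (o k, o' k) := by
  refine ⟨?_, ?_⟩
  · have : O.s (o L) < O.s y.1 := by rw [h.fst.s_eq]; exact (h1 _).1
    have h2 := O.v_sub_of_s_lt this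
    rw [h.fst.s_eq] at h2
    change _ < O.v (y.1 - o L)
    rw [h2]
    exact_mod_cast h.fst.strictMono (by omega)
  · have : O.s (o' L) < O.s y.2 := by rw [h.snd.s_eq]; exact (h1 _).2
    have h2 := O.v_sub_of_s_lt this
    rw [h.snd.s_eq] at h2
    change _ < O.v (y.2 - o' L)
    rw [h2]
    exact_mod_cast h.snd.strictMono (by omega)

/-- Everything depends on which side of the orbit a suitable member of `Ψ` lies. For `Q = 0` it is
`psi y`, to be compared with the value `o k` of `r`. For `Q ≠ 0` write `y = -Q y'` and look at `s
y'`: below the orbit, `y' - s y'` dominates; above it, `y' - o L` is negligible and `r` dominates.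
-/
theorem exists_lead {y r : Γ × Γ} (hy : y ∈ G) (Q : ℚ) {k L : ℤ} (hk : k ≤ L)
    (hr : O.Lead r (o k, o' k)) :
    ∃ c, O.Lead (y + (Q • (o L, o' L) + r)) c ∧ (c ∈ G ∨ ∃ l, c = (o l, o' l)) := by
  by_cases hQ : Q = 0
  · rw [hQ, zero_smul, zero_add]
    by_cases hy0 : y = 0
    · exact ⟨_, by rwa [hy0, zero_add], .inr ⟨k, rfl⟩⟩
    have hc := hG.lead_psi hy hy0
    rcases lt_or_gt hG h (hG.psi_mem hy hy0) (O.psi_mem _ hc.ne_fst) with h1 | h1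
    · exact ⟨_, hc.add_small (hr.small (h1 k).1 (h1 k).2), .inl (hG.psi_mem hy hy0)⟩
    · exact ⟨_, hr.small_add (hc.small (h1 k).1 (h1 k).2), .inr ⟨k, rfl⟩⟩
  · have hy' : (-Q⁻¹) • y ∈ G := G.smul_mem _ hy
    set y' := (-Q⁻¹) • y with hy'_def
    have e : y = -(Q • y') := by
      rw [hy'_def, smul_smul, mul_neg, mul_inv_cancel₀ hQ, neg_one_smul, neg_neg]
    have hd := hG.lead_sub_s hy'
    rcases lt_or_gt hG h (hG.s_mem hy') (O.s_mem _) with h1 | h1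
    · refine ⟨_, ?_, .inl (hG.s_mem hy')⟩
      have e2 : y + (Q • (o L, o' L) + r) = (-Q) • (y' - (O.s y'.1, O.s y'.2)) +
          (Q • ((o L, o' L) - (O.s y'.1, O.s y'.2)) + r) := by
        rw [e, neg_smul, smul_sub, smul_sub]; abel
      rw [e2]
      exact (hd.smul (neg_ne_zero.2 hQ)).add_small
        (((small_sub h (h1 L).1 (h1 L).2).smul Q).add
          (hr.small (h1 k).1 (h1 k).2))
    · refine ⟨_, ?_, .inr ⟨k, rfl⟩⟩
      have e2 : y + (Q • (o L, o' L) + r) = (-Q) • (y' - (o L, o' L)) + r := by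
        rw [e, neg_smul, smul_sub]; abel
      rw [e2]
      exact hr.small_add ((small_sub_of_gt h hk h1).smul _)

/-- Such a `c` computes `s` of the new element. For `Q ≠ 1` put `y' = y / (1 - Q)`; again the
position of `s y'` relative to the orbit decides between `s y'` and `o k`. For `Q = 1` that quotient
is unavailable and `psi y` takes over its role. -/
theorem exists_lead_sub {y r : Γ × Γ} (hy : y ∈ G) (Q : ℚ) {k L : ℤ} (hk : k ≤ L)
    (hr : O.Lead r (o k, o' k)) :
    ∃ c, O.Lead (y + (Q • (o L, o' L) + r) - c) c ∧ (c ∈ G ∨ ∃ l, c = (o l, o' l)) := by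
  have hsm := small_orbit_sub h.fst h.snd hk
  by_cases hQ : Q = 1
  · rw [hQ, one_smul]
    by_cases hy0 : y = 0
    · refine ⟨_, ?_, .inr ⟨k, rfl⟩⟩
      have e : y + ((o L, o' L) + r) - (o k, o' k) = r + ((o L, o' L) - (o k, o' k)) := by
        rw [hy0]; abel
      rw [e]
      exact hr.add_small hsm
    have hc := hG.lead_psi hy hy0
    rcases lt_or_gt hG h (hG.psi_mem hy hy0) (O.psi_mem _ hc.ne_fst) with h1 | h1
    · refine ⟨_, ?_, .inl (hG.psi_mem hy hy0)⟩
      rw [show y + ((o L, o' L) + r) - (O.psi y.1, O.psi y.2) =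
        y + (((o L, o' L) - (O.psi y.1, O.psi y.2)) + r) by abel]
      exact hc.add_small ((small_sub h (h1 L).1 (h1 L).2).add (hr.small (h1 k).1 (h1 k).2))
    · refine ⟨_, ?_, .inr ⟨k, rfl⟩⟩
      rw [show y + ((o L, o' L) + r) - (o k, o' k) =
        r + (y + ((o L, o' L) - (o k, o' k))) by abel]
      exact hr.add_small ((hc.small (h1 k).1 (h1 k).2).add hsm)
  · have hQ' : 1 - Q ≠ 0 := sub_ne_zero.2 (Ne.symm hQ)
    have hy' : (1 - Q)⁻¹ • y ∈ G := G.smul_mem _ hy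
    set y' := (1 - Q)⁻¹ • y with hy'_def
    have e : y = (1 - Q) • y' := by
      rw [hy'_def, smul_smul, mul_inv_cancel₀ hQ', one_smul]
    have hd := hG.lead_sub_s hy'
    rcases lt_or_gt hG h (hG.s_mem hy') (O.s_mem _) with h1 | h1
    · refine ⟨_, ?_, .inl (hG.s_mem hy')⟩
      have e2 : y + (Q • (o L, o' L) + r) - (O.s y'.1, O.s y'.2) =
          (1 - Q) • (y' - (O.s y'.1, O.s y'.2)) +
          (Q • ((o L, o' L) - (O.s y'.1, O.s y'.2)) + r) := by
        rw [e, smul_sub, smul_sub, sub_smul _ _ (O.s y'.1, O.s y'.2), one_smul]; abel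
      rw [e2]
      exact (hd.smul hQ').add_small
        (((small_sub h (h1 L).1 (h1 L).2).smul Q).add
          (hr.small (h1 k).1 (h1 k).2))
    · refine ⟨_, ?_, .inr ⟨k, rfl⟩⟩
      have e2 : y + (Q • (o L, o' L) + r) - (o k, o' k) =
          r + ((1 - Q) • (y' - (o L, o' L)) + ((o L, o' L) - (o k, o' k))) := by
        rw [e, smul_sub, sub_smul _ _ (o L, o' L), one_smul]; abel
      rw [e2]
      exact hr.add_small (((small_sub_of_gt h hk h1).smul _).add hsm)

omit hG in
theorem mem_cases {z : Γ × Γ} (hz : z ∈ adjoinOrbit G o o') :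
    z ∈ G ∨ ∃ y ∈ G, ∃ (Q : ℚ) (L k : ℤ) (r : Γ × Γ), k ≤ L ∧
      z = y + (Q • (o L, o' L) + r) ∧ O.Lead r (o k, o' k) := by
  obtain ⟨y, hy, t, ht, rfl⟩ := Submodule.mem_sup.1 hz
  by_cases h0 : t = 0
  · left; simpa [h0] using hy
  · obtain ⟨Q, L, k, r, h1, rfl, h2⟩ := exists_lead_of_mem_span h.fst h.snd ht h0
    exact .inr ⟨y, hy, Q, L, k, r, h1, rfl, h2⟩

theorem lead_adjoin {z : Γ × Γ} (hz : z ∈ adjoinOrbit G o o') (h0 : z ≠ 0) :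
    ∃ c ∈ adjoinOrbit G o o', O.Lead z c := by
  rcases mem_cases h hz with hz' | ⟨y, hy, Q, L, k, r, hk, rfl, hr⟩
  · obtain ⟨c, h1, h2⟩ := hG.lead z hz' h0
    exact ⟨c, le_adjoinOrbit G o o' h1, h2⟩
  · obtain ⟨c, h1, h2⟩ := exists_lead hG h hy Q hk hr
    exact ⟨c, mem_adjoinOrbit_of_mem_or_eq h2, h1⟩

theorem lead_sub_adjoin {z : Γ × Γ} (hz : z ∈ adjoinOrbit G o o') :
    ∃ c, O.Lead (z - c) c ∧ (c ∈ G ∨ ∃ l, c = (o l, o' l)) := by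
  rcases mem_cases h hz with hz' | ⟨y, hy, Q, L, k, r, hk, rfl, hr⟩
  · obtain ⟨c, h1, h2⟩ := hG.lead_sub z hz'
    exact ⟨c, h2, .inl h1⟩
  · exact exists_lead_sub hG h hy Q hk hr

/-- The only new elements of `Ψ` in the domain are the members of the orbit. -/
theorem mem_or_eq {z : Γ × Γ} (hz : z ∈ adjoinOrbit G o o') (hP : z.1 ∈ O.P) :
    z ∈ G ∨ ∃ l, z = (o l, o' l) := by
  have key : ∀ y ∈ adjoinOrbit G o o', z.1 = y.1 → z = y := by
    intro y hy h1
    by_contra h2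
    obtain ⟨c, -, hc⟩ := lead_adjoin hG h (Submodule.sub_mem _ hz hy) (sub_ne_zero.2 h2)
    exact hc.ne_fst (by simp [h1])
  -- An element of `Ψ` is determined by its successor, here `c.1`, which lies in the old domain or
  -- on the orbit; both are closed under predecessors.
  obtain ⟨c, hc, h1⟩ := lead_sub_adjoin hG h hz
  have hs := hc.s_fst
  rcases h1 with h1 | ⟨l, rfl⟩
  · obtain ⟨b, -, -, hb⟩ := hG.mem_of_s_eq_fst h1 hP hs
    have := key _ (le_adjoinOrbit G o o' hb) rfl
    exact .inl (this ▸ hb)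
  · refine .inr ⟨l - 1, key _ (orbit_mem_adjoinOrbit G o o' _) ?_⟩
    refine O.s_inj hP (h.fst.mem _) (hs.trans ?_)
    rw [h.fst.s_eq, sub_add_cancel]

theorem isPIso_adjoin : O.IsPIso (adjoinOrbit G o o') where
  lead z hz h0 := lead_adjoin hG h hz h0
  lead_sub z hz := by
    obtain ⟨c, hc, h1⟩ := lead_sub_adjoin hG h hz
    exact ⟨c, mem_adjoinOrbit_of_mem_or_eq h1, hc⟩
  mem_P z hz := by
    have h1 : ∀ y, y ∈ G ∨ (∃ l, y = (o l, o' l)) → (y.1 ∈ O.P ↔ y.2 ∈ O.P) := by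
      rintro y (hy | ⟨l, rfl⟩)
      · exact hG.mem_P y hy
      · exact iff_of_true (h.fst.mem l) (h.snd.mem l)
    refine ⟨fun h2 => (h1 z (mem_or_eq hG h hz h2)).1 h2, fun h2 => ?_⟩
    -- The swapped extension is contained in the extension of the swapped graph, so `mem_or_eq` also
    -- applies to second coordinates.
    have hz' : z.swap ∈ adjoinOrbit (G.map (LinearEquiv.prodComm ℚ Γ Γ).toLinearMap) o' o := by
      obtain ⟨y, hy, t, ht, rfl⟩ := Submodule.mem_sup.1 hz
      rw [Prod.swap_add]
      refine Submodule.add_mem_sup (mem_map_prodComm.2 (by simpa using hy)) ?_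
      have := Submodule.mem_map_of_mem (f := (LinearEquiv.prodComm ℚ Γ Γ).toLinearMap) ht
      rw [Submodule.map_span, ← Set.range_comp] at this
      exact this
    rcases mem_or_eq hG.symm (symm hG h) hz' h2 with h3 | ⟨l, h3⟩
    · exact (h1 z (.inl (by simpa using mem_map_prodComm.1 h3))).2 h2
    · exact (h1 z (.inr ⟨l, Prod.swap_injective h3⟩)).2 h2
  pred z hz h1 h2 := by
    rcases mem_or_eq hG h hz h1 with h3 | ⟨l, rfl⟩
    · exact le_adjoinOrbit G o o' (hG.pred z h3 h1 h2)
    · rw [h.fst.p_eq, h.snd.p_eq]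
      exact orbit_mem_adjoinOrbit G o o' _

end IsNewOrbit
end LogOps

/-! ### Adjoining an element that brings no new member of `Ψ`. -/

namespace LogOps

variable {Γ : Type*} [AddCommGroup Γ] [LinearOrder Γ] [IsOrderedAddMonoid Γ] [Module ℚ Γ]
  {O : LogOps Γ}

theorem IsPIso.mem_of_s_eq_snd {G : Submodule ℚ (Γ × Γ)} (hG : O.IsPIso G) {c : Γ × Γ}
    (hc : c ∈ G) {b : Γ} (hb : b ∈ O.P) (h : O.s b = c.2) : ∃ a, (a, b) ∈ G := by
  obtain ⟨a, -, -, ha⟩ := hG.symm.mem_of_s_eq_fst (c := c.swap)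
    (mem_map_prodComm.2 (by simpa using hc)) hb h
  exact ⟨a, mem_map_prodComm.1 ha⟩

theorem IsPIso.lead_of_fst {G : Submodule ℚ (Γ × Γ)} (hG : O.IsPIso G) {z c : Γ × Γ}
    (hz : z ∈ G) (hc : c ∈ G) (h : O.v z.1 = c.1) : O.Lead z c := by
  have h0 : z ≠ 0 := by
    rintro rfl
    simp at h
  obtain ⟨d, hd, h1⟩ := hG.lead z hz h0
  have h2 : d.1 = c.1 := by
    have := h1.fst
    rw [h] at this
    exact_mod_cast this.symm
  rwa [← hG.eq_of_fst hd hc h2]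

theorem IsPIso.le_v_snd {G : Submodule ℚ (Γ × Γ)} (hG : O.IsPIso G) {z c : Γ × Γ}
    (hz : z ∈ G) (hc : c ∈ G) (h : c.1 ≤ O.v z.1) : c.2 ≤ O.v z.2 := by
  by_cases h0 : z = 0
  · simp [h0]
  obtain ⟨d, hd, h1⟩ := hG.lead z hz h0
  rw [h1.fst] at h
  rw [h1.snd]
  have h2 : ¬ d.1 < c.1 := not_lt.2 (by exact_mod_cast h)
  rw [hG.lt_iff hd hc, not_lt] at h2
  exact_mod_cast h2

/-- Adjoining a pair of elements that adds no new element of `Ψ`. -/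
theorem IsPIso.adjoin {G : Submodule ℚ (Γ × Γ)} (hG : O.IsPIso G) {x x' : Γ}
    (hlead : ∀ z ∈ G, ∃ c ∈ G, O.Lead ((x, x') - z) c)
    (hs : ∀ z ∈ G, ∀ q : ℚ, q ≠ 0 → ∃ c ∈ G, O.s (z.1 + q • x) = c.1)
    (hP : ∀ z ∈ G, ∀ q : ℚ, q ≠ 0 → z.1 + q • x ∉ O.P) :
    O.IsPIso (G ⊔ Submodule.span ℚ {(x, x')}) := by
  have hle : G ≤ G ⊔ Submodule.span ℚ {(x, x')} := le_sup_left
  have cases : ∀ z ∈ G ⊔ Submodule.span ℚ {(x, x')},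
      z ∈ G ∨ ∃ y ∈ G, ∃ q : ℚ, q ≠ 0 ∧ z = y + q • (x, x') := by
    intro z hz
    obtain ⟨y, hy, t, ht, rfl⟩ := Submodule.mem_sup.1 hz
    obtain ⟨q, rfl⟩ := Submodule.mem_span_singleton.1 ht
    by_cases hq : q = 0
    · left; simpa [hq] using hy
    · exact .inr ⟨y, hy, q, hq, rfl⟩
  have lead : ∀ y ∈ G, ∀ q : ℚ, q ≠ 0 → ∃ c ∈ G, O.Lead (y + q • (x, x')) c := by
    intro y hy q hq
    obtain ⟨c, hc, h⟩ := hlead _ (G.smul_mem (-q⁻¹) hy)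
    refine ⟨c, hc, ?_⟩
    have := h.smul hq
    rwa [smul_sub, smul_smul, mul_neg, mul_inv_cancel₀ hq, neg_one_smul, sub_neg_eq_add,
      add_comm] at this
  -- `hs` controls only the first coordinate. The leading value `d` of the difference has `d.1 =
  -- c.1`, so `d = c`, and the second coordinate follows.
  have lead_sub : ∀ y ∈ G, ∀ q : ℚ, q ≠ 0 → ∃ c ∈ G, O.Lead (y + q • (x, x') - c) c := by
    intro y hy q hq
    obtain ⟨c, hc, h⟩ := hs y hy q hq
    obtain ⟨d, hd, h1⟩ := lead _ (G.sub_mem hy hc) q hq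
    have e : y + q • (x, x') - c = y - c + q • (x, x') := by abel
    have h2 : d.1 = c.1 := by
      have h3 := h1.fst
      rw [← e, Prod.fst_sub, Prod.fst_add, Prod.smul_fst, ← h, O.v_sub_s, h] at h3
      exact_mod_cast h3.symm
    rw [hG.eq_of_fst hd hc h2, ← e] at h1
    exact ⟨c, hc, h1⟩
  refine ⟨?_, ?_, ?_, ?_⟩
  · intro z hz h0
    rcases cases z hz with h | ⟨y, hy, q, hq, rfl⟩
    · obtain ⟨c, hc, h1⟩ := hG.lead z h h0
      exact ⟨c, hle hc, h1⟩
    · obtain ⟨c, hc, h1⟩ := lead y hy q hq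
      exact ⟨c, hle hc, h1⟩
  · intro z hz
    rcases cases z hz with h | ⟨y, hy, q, hq, rfl⟩
    · obtain ⟨c, hc, h1⟩ := hG.lead_sub z h
      exact ⟨c, hle hc, h1⟩
    · obtain ⟨c, hc, h1⟩ := lead_sub y hy q hq
      exact ⟨c, hle hc, h1⟩
  · intro z hz
    rcases cases z hz with h | ⟨y, hy, q, hq, rfl⟩
    · exact hG.mem_P z h
    -- If the second coordinate were in `Ψ`, then, its successor being in the range of `G`, so would
    -- it be; subtracting gives an element with second component `0`, which has no leading value.
    · refine iff_of_false (hP y hy q hq) fun h2 => ?_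
      obtain ⟨c, hc, h1⟩ := lead_sub y hy q hq
      obtain ⟨a, ha⟩ := hG.mem_of_s_eq_snd hc h2 h1.s_snd
      obtain ⟨d, -, h3⟩ := lead _ (G.sub_mem hy ha) q hq
      refine h3.ne_snd ?_
      simp
  · intro z hz h1 h2
    rcases cases z hz with h | ⟨y, hy, q, hq, rfl⟩
    · exact hle (hG.pred z h h1 h2)
    · exact absurd h1 (hP y hy q hq)

/-- Adding a nonnegative element to a positive one cannot raise the value, and the ultrametric
inequality keeps it from falling below `c`. -/
theorem v_eq_of_le {a b : Γ} {c : WithTop Γ} (ha : 0 < a) (h0 : O.v a = c) (hb : 0 ≤ b)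
    (h : c ≤ O.v b) : O.v (a + b) = c :=
  le_antisymm (h0 ▸ O.v_anti ha (le_add_of_nonneg_right hb)) (O.le_v_add h0.ge h)

/-- Finitely many conditions on the image of `x` can be met simultaneously. -/
theorem IsPIso.exists_lead_finset {G : Submodule ℚ (Γ × Γ)} (hG : O.IsPIso G) {x : Γ}
    (hx : ∀ z ∈ G, ∃ c ∈ G, O.v (x - z.1) = c.1) (T : Finset (Γ × Γ)) (hT : ∀ z ∈ T, z ∈ G) :
    ∃ x', ∀ z ∈ T, ∀ c ∈ G, O.v (x - z.1) = c.1 → O.Lead ((x, x') - z) c := by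
  rcases T.eq_empty_or_nonempty with rfl | hne
  · exact ⟨0, by simp⟩
  -- Only the points of `T` nearest to `x`, those with maximal value of `x - z`, constrain `x'`; for
  -- any other `z` the difference `z₀ - z` dominates.
  obtain ⟨z₀, hz₀, hmax⟩ := T.exists_max_image (fun z => O.v (x - z.1)) hne
  obtain ⟨c, hc, hc₀⟩ := hx z₀ (hT z₀ hz₀)
  have hcP : c.2 ∈ O.P := by
    obtain ⟨h1, h2⟩ := O.v_eq_coe.1 hc₀
    exact (hG.mem_P c hc).1 (h2 ▸ O.psi_mem _ h1)
  have hw : O.v (O.w c.2) = c.2 :=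
    O.v_eq_coe.2 ⟨(O.w_spec _ hcP).1.ne', (O.w_spec _ hcP).2⟩
  have hxne : ∀ z ∈ G, z.1 ≠ x := by
    rintro z hz rfl
    obtain ⟨d, -, hd⟩ := hx z hz
    simp at hd
  classical
  set S := T.filter fun z => O.v (x - z.1) = c.1 with hS
  have hSG : ∀ z ∈ S, z ∈ G := fun z hz => hT z (Finset.mem_filter.1 hz).1
  have hSv : ∀ z ∈ S, O.v (x - z.1) = c.1 := fun z hz => (Finset.mem_filter.1 hz).2
  have hdiff : ∀ a ∈ S, ∀ b ∈ S, (c.2 : WithTop Γ) ≤ O.v (a.2 - b.2) := by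
    intro a ha b hb
    refine hG.le_v_snd (z := a - b) (G.sub_mem (hSG a ha) (hSG b hb)) hc ?_
    have : (a - b).1 = -(x - a.1) + (x - b.1) := by simp
    rw [this]
    exact O.le_v_add (by rw [v_neg, hSv a ha]) (hSv b hb).ge
  -- It is enough to be at distance of value `c.2` from the nearest point of `S` on each side;
  -- `v_eq_of_le` then covers the farther ones. With neighbours on both sides the midpoint works, as
  -- their difference has value `c` as well; with one, shift it by `w c.2`.
  have main : ∃ x', (∀ a ∈ S, a.1 < x → 0 < x' - a.2 ∧ O.v (x' - a.2) = c.2) ∧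
      ∀ b ∈ S, x < b.1 → 0 < b.2 - x' ∧ O.v (b.2 - x') = c.2 := by
    have below : ∀ a ∈ S, (∀ b ∈ S, b.1 < x → b.1 ≤ a.1) → ∀ x', 0 < x' - a.2 →
        O.v (x' - a.2) = c.2 → ∀ b ∈ S, b.1 < x → 0 < x' - b.2 ∧ O.v (x' - b.2) = c.2 := by
      intro a ha h1 x' h2 h3 b hb hbx
      have h4 : 0 ≤ a.2 - b.2 := by
        have := h1 b hb hbx
        rw [← not_lt, hG.lt_iff (hSG a ha) (hSG b hb), not_lt] at this
        exact sub_nonneg.2 this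
      have e : x' - b.2 = (x' - a.2) + (a.2 - b.2) := by abel
      rw [e]
      exact ⟨add_pos_of_pos_of_nonneg h2 h4, v_eq_of_le h2 h3 h4 (hdiff a ha b hb)⟩
    have above : ∀ a ∈ S, (∀ b ∈ S, x < b.1 → a.1 ≤ b.1) → ∀ x', 0 < a.2 - x' →
        O.v (a.2 - x') = c.2 → ∀ b ∈ S, x < b.1 → 0 < b.2 - x' ∧ O.v (b.2 - x') = c.2 := by
      intro a ha h1 x' h2 h3 b hb hbx
      have h4 : 0 ≤ b.2 - a.2 := by
        have := h1 b hb hbx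
        rw [← not_lt, hG.lt_iff (hSG b hb) (hSG a ha), not_lt] at this
        exact sub_nonneg.2 this
      have e : b.2 - x' = (a.2 - x') + (b.2 - a.2) := by abel
      rw [e]
      exact ⟨add_pos_of_pos_of_nonneg h2 h4, v_eq_of_le h2 h3 h4 (hdiff b hb a ha)⟩
    rcases (S.filter fun a => a.1 < x).eq_empty_or_nonempty with hA | hA
    · rcases (S.filter fun a => x < a.1).eq_empty_or_nonempty with hB | hB
      · refine ⟨0, fun a ha hax => ?_, fun a ha hax => ?_⟩
        · exact absurd hax (Finset.filter_eq_empty_iff.1 hA ha)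
        · exact absurd hax (Finset.filter_eq_empty_iff.1 hB ha)
      · obtain ⟨b, hb, hbmin⟩ := Finset.exists_min_image _ (fun z : Γ × Γ => z.1) hB
        refine ⟨b.2 - O.w c.2, fun a ha hax => ?_, above b (Finset.mem_filter.1 hb).1 ?_ _ ?_ ?_⟩
        · exact absurd hax (Finset.filter_eq_empty_iff.1 hA ha)
        · exact fun z hz hzx => hbmin z (Finset.mem_filter.2 ⟨hz, hzx⟩)
        · rw [sub_sub_cancel]; exact (O.w_spec _ hcP).1
        · rw [sub_sub_cancel]; exact hw
    · obtain ⟨a, ha, hamax⟩ := Finset.exists_max_image _ (fun z : Γ × Γ => z.1) hA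
      have ha' := Finset.mem_filter.1 ha
      have hamax' : ∀ z ∈ S, z.1 < x → z.1 ≤ a.1 := fun z hz hzx =>
        hamax z (Finset.mem_filter.2 ⟨hz, hzx⟩)
      rcases (S.filter fun a => x < a.1).eq_empty_or_nonempty with hB | hB
      · refine ⟨a.2 + O.w c.2, below a ha'.1 hamax' _ ?_ ?_, fun a ha hax => ?_⟩
        · rw [add_sub_cancel_left]; exact (O.w_spec _ hcP).1
        · rw [add_sub_cancel_left]; exact hw
        · exact absurd hax (Finset.filter_eq_empty_iff.1 hB ha)
      · obtain ⟨b, hb, hbmin⟩ := Finset.exists_min_image _ (fun z : Γ × Γ => z.1) hB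
        have hb' := Finset.mem_filter.1 hb
        have hbmin' : ∀ z ∈ S, x < z.1 → b.1 ≤ z.1 := fun z hz hzx =>
          hbmin z (Finset.mem_filter.2 ⟨hz, hzx⟩)
        have hba : b - a ∈ G := G.sub_mem (hSG b hb'.1) (hSG a ha'.1)
        have hL : O.Lead (b - a) c := by
          refine hG.lead_of_fst hba hc ?_
          have h1 := v_eq_of_le (O := O) (sub_pos.2 ha'.2) (hSv a ha'.1)
            (sub_nonneg.2 hb'.2.le) (by rw [O.v_sub_comm, hSv b hb'.1])
          rw [← h1, Prod.fst_sub]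
          congr 1
          abel
        have hpos : 0 < b.2 - a.2 :=
          hL.pos.1 (sub_pos.2 (ha'.2.trans hb'.2) : 0 < b.1 - a.1)
        have hhalf : (0 : ℚ) < 1 / 2 := by norm_num
        have e1 : a.2 + (1 / 2 : ℚ) • (b.2 - a.2) - a.2 = (1 / 2 : ℚ) • (b.2 - a.2) := by abel
        have e2 : b.2 - (a.2 + (1 / 2 : ℚ) • (b.2 - a.2)) = (1 / 2 : ℚ) • (b.2 - a.2) := by
          module
        refine ⟨a.2 + (1 / 2 : ℚ) • (b.2 - a.2), below a ha'.1 hamax' _ ?_ ?_,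
          above b hb'.1 hbmin' _ ?_ ?_⟩
        · rw [e1]; exact rat_smul_pos hhalf hpos
        · rw [e1, O.v_smul hhalf.ne']; exact hL.snd
        · rw [e2]; exact rat_smul_pos hhalf hpos
        · rw [e2, O.v_smul hhalf.ne']; exact hL.snd
  obtain ⟨x', hA, hB⟩ := main
  have hlead : ∀ z ∈ S, O.Lead ((x, x') - z) c := by
    intro z hz
    rcases lt_or_gt_of_ne (hxne z (hSG z hz)) with h | h
    · obtain ⟨h1, h2⟩ := hA z hz h
      exact ⟨hSv z hz, h2, iff_of_true (sub_pos.2 h) h1⟩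
    · obtain ⟨h1, h2⟩ := hB z hz h
      refine ⟨hSv z hz, ?_, ?_⟩
      · rw [Prod.snd_sub, O.v_sub_comm]; exact h2
      · refine iff_of_false ?_ ?_
        · exact not_lt.2 (sub_neg.2 h).le
        · exact not_lt.2 (sub_neg.2 (sub_pos.1 h1)).le
  refine ⟨x', fun z hz d hd hzd => ?_⟩
  by_cases hzc : O.v (x - z.1) = c.1
  · have : d = c := hG.eq_of_fst hd hc (by rw [hzd] at hzc; exact_mod_cast hzc)
    exact this ▸ hlead z (Finset.mem_filter.2 ⟨hz, hzc⟩)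
  · have hlt : O.v (x - z.1) < O.v (x - z₀.1) :=
      lt_of_le_of_ne (hmax z hz) (hc₀ ▸ hzc)
    have hdc : d.1 < c.1 := by rw [hzd, hc₀] at hlt; exact_mod_cast hlt
    have h0 := hlead z₀ (Finset.mem_filter.2 ⟨hz₀, hc₀⟩)
    have h1 : O.Lead (z₀ - z) d := by
      refine hG.lead_of_fst (G.sub_mem (hT z₀ hz₀) (hT z hz)) hd ?_
      have e : (z₀ - z).1 = (x - z.1) + -(x - z₀.1) := by simp
      rw [e, O.v_add_eq (by rwa [v_neg]), hzd]
    have e : (x, x') - z = (z₀ - z) + ((x, x') - z₀) := by abel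
    rw [e]
    exact h1.add_small (h0.small hdc ((hG.lt_iff hd hc).1 hdc))

end LogOps

/-! ### Ultrapowers and their saturation. -/

open Filter in
/-- The ultrapower of `Γ` along a nonprincipal ultrafilter on `ℕ`. -/
abbrev Ultrapower (Γ : Type*) := Germ ((hyperfilter ℕ : Ultrafilter ℕ) : Filter ℕ) Γ

open Filter in
/-- Countable saturation of ultrapowers along a nonprincipal ultrafilter on `ℕ`. -/
theorem exists_seq_of_finite_satisfiable {Γ ι : Type*} [Countable ι] [Nonempty Γ]
    (S : ι → ℕ → Set Γ)
    (h : ∀ T : Finset ι, ∀ᶠ n in hyperfilter ℕ, ∃ x, ∀ j ∈ T, x ∈ S j n) :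
    ∃ g : ℕ → Γ, ∀ j, ∀ᶠ n in hyperfilter ℕ, g n ∈ S j n := by
  classical
  obtain ⟨e, he⟩ := exists_injective_nat ι
  have hfin : ∀ k, {j | e j < k}.Finite := fun k =>
    (Set.finite_lt_nat k).preimage he.injOn
  -- Diagonal choice: at `n`, meet the conditions with code below `k` for the largest possible `k ≤
  -- n`. The cap `n` makes this maximum exist, and it still exceeds every fixed code for almost all
  -- `n`.
  let ok (n k : ℕ) : Prop := ∃ x, ∀ j, e j < k → x ∈ S j n
  have ok_zero : ∀ n, ok n 0 := fun n => ⟨Classical.arbitrary Γ, fun j hj => absurd hj (by omega)⟩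
  have hx : ∀ n, ∃ x, ∀ j, e j < Nat.findGreatest (ok n) n → x ∈ S j n := fun n =>
    Nat.findGreatest_spec (P := ok n) (Nat.zero_le n) (ok_zero n)
  choose g hg using hx
  refine ⟨g, fun j => ?_⟩
  have h1 : ∀ᶠ n in hyperfilter ℕ, e j + 1 ≤ n :=
    Nat.hyperfilter_le_atTop (eventually_ge_atTop _)
  filter_upwards [h1, h (hfin (e j + 1)).toFinset] with n hn1 hn2
  refine hg n j (Nat.lt_of_succ_le (Nat.le_findGreatest hn1 ?_))
  obtain ⟨x, hx⟩ := hn2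
  exact ⟨x, fun i hi => hx i ((hfin _).mem_toFinset.2 hi)⟩

open Filter in
theorem germ_ne_iff {Γ : Type*} {f g : ℕ → Γ} :
    (f : Ultrapower Γ) ≠ g ↔ ∀ᶠ n in hyperfilter ℕ, f n ≠ g n :=
  Germ.coe_eq.not.trans Ultrafilter.eventually_not.symm

namespace LogOps

open Filter

variable {Γ : Type*} [AddCommGroup Γ] [LinearOrder Γ] [IsOrderedAddMonoid Γ] [Module ℚ Γ]
  (O : LogOps Γ)

omit [LinearOrder Γ] [IsOrderedAddMonoid Γ] [Module ℚ Γ] in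
theorem germ_ne_zero_iff {f : ℕ → Γ} :
    (f : Ultrapower Γ) ≠ 0 ↔ ∀ᶠ n in hyperfilter ℕ, f n ≠ 0 := germ_ne_iff (g := 0)

/-- The operations on the ultrapower. -/
noncomputable def germ : LogOps (Ultrapower Γ) where
  psi := Germ.map O.psi
  s := Germ.map O.s
  p := Germ.map O.p
  w := Germ.map O.w
  P := {x | x.LiftPred (· ∈ O.P)}
  psi_add a b := by
    induction a, b using Germ.inductionOn₂ with | _ f g
    intro h1 h2 h3
    rw [germ_ne_zero_iff] at h1 h2
    rw [← Germ.coe_add, germ_ne_zero_iff] at h3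
    rw [Germ.map_coe, Germ.map_coe, Germ.min_def, Germ.map₂_coe, ← Germ.coe_add, Germ.map_coe,
      Germ.coe_le]
    filter_upwards [h1, h2, h3] with n h1 h2 h3 using O.psi_add _ _ h1 h2 h3
  psi_smul q a := by
    induction a using Germ.inductionOn with | _ f
    intro hq h
    rw [germ_ne_zero_iff] at h
    rw [← Germ.coe_smul, Germ.map_coe, Germ.map_coe, Germ.coe_eq]
    filter_upwards [h] with n h using O.psi_smul q _ hq h
  psi_lt a b := by
    induction a, b using Germ.inductionOn₂ with | _ f g
    intro h1 h2
    rw [germ_ne_zero_iff] at h2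
    rw [Germ.coe_pos] at h1
    rw [Germ.map_coe, Germ.map_coe, ← Germ.coe_add, Germ.coe_lt]
    filter_upwards [h1, h2] with n h1 h2 using O.psi_lt _ _ h1 h2
  psi_anti a b := by
    induction a, b using Germ.inductionOn₂ with | _ f g
    intro h1 h2
    rw [Germ.coe_pos] at h1
    rw [Germ.coe_le] at h2
    rw [Germ.map_coe, Germ.map_coe, Germ.coe_le]
    filter_upwards [h1, h2] with n h1 h2 using O.psi_anti _ _ h1 h2
  s_spec a := by
    induction a using Germ.inductionOn with | _ f
    rw [Germ.map_coe, germ_ne_iff, ← Germ.coe_sub, Germ.map_coe, Germ.coe_eq]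
    exact ⟨.of_forall fun n => (O.s_spec _).1, .of_forall fun n => (O.s_spec _).2⟩
  s_unique a c := by
    induction a, c using Germ.inductionOn₂ with | _ f g
    intro h1 h2
    rw [germ_ne_iff] at h1
    rw [← Germ.coe_sub, Germ.map_coe, Germ.coe_eq] at h2
    rw [Germ.map_coe, Germ.coe_eq]
    filter_upwards [h1, h2] with n h1 h2 using O.s_unique _ _ h1 h2
  psi_mem a := by
    induction a using Germ.inductionOn with | _ f
    intro h
    rw [germ_ne_zero_iff] at h
    rw [Germ.map_coe, Set.mem_ofPred_eq, Germ.liftPred_coe]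
    filter_upwards [h] with n h using O.psi_mem _ h
  w_spec c := by
    induction c using Germ.inductionOn with | _ f
    intro h
    rw [Set.mem_ofPred_eq, Germ.liftPred_coe] at h
    rw [Germ.map_coe, Germ.map_coe, Germ.coe_pos, Germ.coe_eq]
    exact ⟨by filter_upwards [h] with n h using (O.w_spec _ h).1,
      by filter_upwards [h] with n h using (O.w_spec _ h).2⟩
  s_zero_le c := by
    induction c using Germ.inductionOn with | _ f
    intro h
    rw [Set.mem_ofPred_eq, Germ.liftPred_coe] at h
    change ((O.s ∘ 0 : ℕ → Γ) : Ultrapower Γ) ≤ f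
    rw [Germ.coe_le]
    filter_upwards [h] with n h using O.s_zero_le _ h
  lt_s c := by
    induction c using Germ.inductionOn with | _ f
    intro h
    rw [Set.mem_ofPred_eq, Germ.liftPred_coe] at h
    rw [Germ.map_coe, Germ.coe_lt]
    filter_upwards [h] with n h using O.lt_s _ h
  s_le c d := by
    induction c, d using Germ.inductionOn₂ with | _ f g
    intro h1 h2 h3
    rw [Set.mem_ofPred_eq, Germ.liftPred_coe] at h1 h2
    rw [Germ.coe_lt] at h3
    rw [Germ.map_coe, Germ.coe_le]
    filter_upwards [h1, h2, h3] with n h1 h2 h3 using O.s_le _ _ h1 h2 h3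
  p_spec c := by
    induction c using Germ.inductionOn with | _ f
    intro h1 h2
    rw [Set.mem_ofPred_eq, Germ.liftPred_coe] at h1
    change ((O.s ∘ 0 : ℕ → Γ) : Ultrapower Γ) < f at h2
    rw [Germ.coe_lt] at h2
    rw [Germ.map_coe, Set.mem_ofPred_eq, Germ.liftPred_coe, Germ.map_coe, Germ.coe_eq]
    exact ⟨by filter_upwards [h1, h2] with n h1 h2 using (O.p_spec _ h1 h2).1,
      by filter_upwards [h1, h2] with n h1 h2 using (O.p_spec _ h1 h2).2⟩

variable {O}

theorem coe_mem_germ_P {f : ℕ → Γ} :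
    (f : Ultrapower Γ) ∈ O.germ.P ↔ ∀ᶠ n in hyperfilter ℕ, f n ∈ O.P := Iff.rfl

theorem germ_v_coe {f g : ℕ → Γ} :
    O.germ.v f = ((g : Ultrapower Γ) : WithTop (Ultrapower Γ)) ↔
      ∀ᶠ n in hyperfilter ℕ, O.v (f n) = g n := by
  simp only [v_eq_coe, eventually_and, germ_ne_zero_iff]
  exact and_congr_right fun _ => Germ.coe_eq

theorem eventually_iff_const {p : ℕ → Prop} {b : Prop} :
    (∀ᶠ n in hyperfilter ℕ, (b ↔ p n)) ↔ (b ↔ ∀ᶠ n in hyperfilter ℕ, p n) := by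
  by_cases hb : b
  · simp [hb]
  · simp only [hb, false_iff]
    exact Ultrafilter.eventually_not

/-- An element that adds no new element of `Ψ` has a counterpart. -/
theorem IsPIso.exists_adjoin {G : Submodule ℚ (Ultrapower Γ × Ultrapower Γ)} [Countable G]
    (hG : O.germ.IsPIso G) {x : Ultrapower Γ}
    (hx : ∀ z ∈ G, ∃ c ∈ G, O.germ.v (x - z.1) = c.1)
    (hs : ∀ z ∈ G, ∀ q : ℚ, q ≠ 0 → ∃ c ∈ G, O.germ.s (z.1 + q • x) = c.1)
    (hP : ∀ z ∈ G, ∀ q : ℚ, q ≠ 0 → z.1 + q • x ∉ O.germ.P) :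
    ∃ x', O.germ.IsPIso (G ⊔ Submodule.span ℚ {(x, x')}) := by
  have hrep : ∀ a : Ultrapower Γ, ∃ f : ℕ → Γ, (f : Ultrapower Γ) = a := fun a =>
    a.inductionOn fun f => ⟨f, rfl⟩
  choose rep hrep using hrep
  have hx' : ∀ z : G, ∃ c ∈ G, O.germ.v (x - z.1.1) = c.1 := fun z => hx z.1 z.2
  choose val hval hval' using hx'
  have key : ∀ (z : G) (g : ℕ → Γ), O.germ.Lead ((x, (g : Ultrapower Γ)) - z) (val z) ↔
      ∀ᶠ n in hyperfilter ℕ, O.v (g n - rep z.1.2 n) = rep (val z).2 n ∧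
        (0 < x - z.1.1 ↔ 0 < g n - rep z.1.2 n) := by
    intro z g
    rw [eventually_and, eventually_iff_const]
    have e : (g : Ultrapower Γ) - z.1.2 = ((g - rep z.1.2 : ℕ → Γ) : Ultrapower Γ) := by
      rw [Germ.coe_sub, hrep]
    have h1 : O.germ.v ((g : Ultrapower Γ) - z.1.2) = (val z).2 ↔
        ∀ᶠ n in hyperfilter ℕ, O.v (g n - rep z.1.2 n) = rep (val z).2 n := by
      rw [e]
      conv_lhs => rw [← hrep (val z).2]
      exact germ_v_coe
    have h2 : 0 < (g : Ultrapower Γ) - z.1.2 ↔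
        ∀ᶠ n in hyperfilter ℕ, 0 < g n - rep z.1.2 n := by
      rw [e]; exact Germ.coe_pos
    rw [← h1, ← h2]
    exact ⟨fun h => ⟨h.snd, h.pos⟩, fun h => ⟨hval' z, h.1, h.2⟩⟩
  -- There is one condition on `x'` for each of the countably many members of `G`; finite
  -- subfamilies are met by `exists_lead_finset`.
  obtain ⟨g, hg⟩ := exists_seq_of_finite_satisfiable (ι := G)
    (fun z n => {t | O.v (t - rep z.1.2 n) = rep (val z).2 n ∧
      (0 < x - z.1.1 ↔ 0 < t - rep z.1.2 n)}) (by
    intro T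
    classical
    obtain ⟨x', h⟩ := hG.exists_lead_finset hx (T.image Subtype.val) (by
      intro z hz
      obtain ⟨y, -, rfl⟩ := Finset.mem_image.1 hz
      exact y.2)
    induction x' using Germ.inductionOn with | _ g
    have h2 : ∀ᶠ n in hyperfilter ℕ, ∀ z ∈ T, O.v (g n - rep z.1.2 n) = rep (val z).2 n ∧
        (0 < x - z.1.1 ↔ 0 < g n - rep z.1.2 n) := by
      rw [Filter.eventually_all_finset]
      exact fun z hz => (key z g).1
        (h z (Finset.mem_image_of_mem _ hz) _ (hval z) (hval' z))
    filter_upwards [h2] with n h3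
    exact ⟨g n, h3⟩)
  exact ⟨g, hG.adjoin (fun z hz => ⟨_, hval ⟨z, hz⟩, (key ⟨z, hz⟩ g).2 (hg _)⟩) hs hP⟩

end LogOps

/-! ### Extending a countable partial isomorphism to a given element. -/

/-- A countable set is contained in a countable subspace closed under countably many maps. -/
theorem exists_countable_closed {Γ ι : Type*} [AddCommGroup Γ] [Module ℚ Γ] [Countable ι]
    (f : ι → Γ → Γ) {S : Set Γ} (hS : S.Countable) :
    ∃ D : Submodule ℚ Γ, Countable D ∧ S ⊆ D ∧ ∀ i, ∀ a ∈ D, f i a ∈ D := by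
  have hspan : ∀ T : Set Γ, T.Countable → Countable (Submodule.span ℚ T) := by
    intro T hT
    have : Countable T := hT
    have := (inferInstance : Countable (Submodule.span ℚ (Set.range (fun t : T => (t : Γ)))))
    rwa [Subtype.range_coe] at this
  obtain ⟨E, hE0, hE⟩ : ∃ E : ℕ → Submodule ℚ Γ, E 0 = Submodule.span ℚ S ∧
      ∀ n, E (n + 1) = Submodule.span ℚ (E n ∪ ⋃ i, f i '' E n) :=
    ⟨fun n => Nat.rec (Submodule.span ℚ S) (fun _ D => Submodule.span ℚ (D ∪ ⋃ i, f i '' D)) n,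
      rfl, fun _ => rfl⟩
  have hcount : ∀ n, Countable (E n) := by
    intro n
    induction n with
    | zero => exact hE0 ▸ hspan S hS
    | succ n ih =>
      rw [hE]
      have h : (E n : Set Γ).Countable := ih
      exact hspan _ (h.union (Set.countable_iUnion fun i => h.image _))
  have hmono : Monotone E := monotone_nat_of_le_succ fun n => by
    rw [hE]
    exact fun a ha => Submodule.subset_span (.inl ha)
  have hmem : ∀ a, a ∈ ⨆ n, E n ↔ ∃ n, a ∈ E n := fun a =>
    Submodule.mem_iSup_of_directed _ hmono.directed_le
  refine ⟨⨆ n, E n, ?_, ?_, ?_⟩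
  · have : ((⨆ n, E n : Submodule ℚ Γ) : Set Γ) = ⋃ n, (E n : Set Γ) := by
      ext a
      simp [hmem]
    change ((⨆ n, E n : Submodule ℚ Γ) : Set Γ).Countable
    rw [this]
    exact Set.countable_iUnion fun n => hcount n
  · intro a ha
    exact (hmem a).2 ⟨0, hE0 ▸ Submodule.subset_span ha⟩
  · intro i a ha
    obtain ⟨n, hn⟩ := (hmem a).1 ha
    refine (hmem _).2 ⟨n + 1, ?_⟩
    rw [hE]
    exact Submodule.subset_span (.inr (Set.mem_iUnion.2 ⟨i, a, hn, rfl⟩))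

namespace LogOps

open Filter

variable {Γ : Type*} [AddCommGroup Γ] [LinearOrder Γ] [IsOrderedAddMonoid Γ] [Module ℚ Γ]
  {O : LogOps Γ}

/-- Iterating from `u` never enters `D`: `hp` excludes it going up, `hs` going down. As `s 0 ∈ D`,
the descent never meets the least element of `Ψ`, so predecessors always exist. -/
theorem exists_isOrbit {D : Set Γ} (h0 : O.s 0 ∈ D) (hs : ∀ a ∈ D, O.s a ∈ D)
    (hp : ∀ a ∈ O.P, O.s a ∈ D → a ∈ D) {u : Γ} (hu : u ∈ O.P) (huD : u ∉ D) :
    ∃ o, O.IsOrbit o ∧ o 0 = u ∧ ∀ l, o l ∉ D := by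
  have hpos : ∀ c, c ∈ O.P → c ∉ D → O.s 0 < c := fun c hc hcD =>
    lt_of_le_of_ne (O.s_zero_le c hc) (by rintro rfl; exact hcD h0)
  have hback : ∀ k, O.p^[k] u ∈ O.P ∧ O.p^[k] u ∉ D := by
    intro k
    induction k with
    | zero => exact ⟨hu, huD⟩
    | succ k ih =>
      rw [Function.iterate_succ_apply']
      obtain ⟨h1, h2⟩ := O.p_spec _ ih.1 (hpos _ ih.1 ih.2)
      exact ⟨h1, fun h3 => ih.2 (h2 ▸ hs _ h3)⟩
  have hforth : ∀ k, O.s^[k] u ∈ O.P ∧ O.s^[k] u ∉ D := by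
    intro k
    induction k with
    | zero => exact ⟨hu, huD⟩
    | succ k ih =>
      rw [Function.iterate_succ_apply']
      exact ⟨O.s_mem _, fun h3 => ih.2 (hp _ ih.1 h3)⟩
  let o : ℤ → Γ := fun l => match l with
    | .ofNat k => O.s^[k] u
    | .negSucc k => O.p^[k + 1] u
  have ho : ∀ l, o l ∈ O.P ∧ o l ∉ D := by
    rintro (k | k)
    · exact hforth k
    · exact hback (k + 1)
  refine ⟨o, ⟨fun l => (ho l).1, ?_⟩, rfl, fun l => (ho l).2⟩
  have hsp : ∀ k, O.s (O.p^[k + 1] u) = O.p^[k] u := fun k => by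
    rw [Function.iterate_succ_apply']
    exact (O.p_spec _ (hback k).1 (hpos _ (hback k).1 (hback k).2)).2
  rintro (k | k | k)
  · exact (Function.iterate_succ_apply' O.s k u).symm
  · exact hsp 0
  · exact hsp (k + 1)

/-- An element of `Ψ` outside of the domain gives rise to a new pair of orbits. -/
theorem IsPIso.exists_isNewOrbit {G : Submodule ℚ (Γ × Γ)} (hG : O.IsPIso G) {u u' : Γ}
    (hu : u ∈ O.P) (hu' : u' ∈ O.P) (huG : ∀ b, (u, b) ∉ G)
    (hcut : ∀ z ∈ G, z.1 ∈ O.P → (z.1 < u → z.2 < u') ∧ (u < z.1 → u' < z.2)) :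
    ∃ o o', o 0 = u ∧ o' 0 = u' ∧ O.IsNewOrbit G o o' := by
  have aux : ∀ {H : Submodule ℚ (Γ × Γ)}, O.IsPIso H → ∀ {c : Γ}, c ∈ O.P → (∀ b, (c, b) ∉ H) →
      ∃ o, O.IsOrbit o ∧ o 0 = c ∧ ∀ l, o l ∉ {a | ∃ b, (a, b) ∈ H} := by
    intro H hH c hc hcH
    refine exists_isOrbit (D := {a | ∃ b, (a, b) ∈ H}) ⟨_, hH.s_zero_mem⟩ ?_ ?_ hc
      (fun ⟨b, hb⟩ => hcH b hb)
    · rintro a ⟨b, hb⟩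
      exact ⟨_, hH.s_mem hb⟩
    · rintro a ha ⟨b, hb⟩
      obtain ⟨d, -, -, hd⟩ := hH.mem_of_s_eq_fst hb ha rfl
      exact ⟨d, hd⟩
  obtain ⟨o, ho, ho0, hoG⟩ := aux hG hu huG
  have hu'G : ∀ a, (a, u') ∉ G := by
    intro a ha
    have haP : a ∈ O.P := (hG.mem_P _ ha).2 hu'
    rcases lt_trichotomy a u with h | h | h
    · exact lt_irrefl _ ((hcut _ ha haP).1 h)
    · exact huG _ (h ▸ ha)
    · exact lt_irrefl _ ((hcut _ ha haP).2 h)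
  obtain ⟨o', ho', ho0', hoG'⟩ := aux hG.symm hu' (fun b hb => hu'G b (mem_map_prodComm.1 hb))
  refine ⟨o, o', ho0, ho0', ho, ho', ?_, ?_, ?_⟩
  · rintro ⟨a, b⟩ hz l rfl
    exact hoG l ⟨b, hz⟩
  · rintro ⟨a, b⟩ hz l rfl
    exact hoG' l ⟨a, mem_map_prodComm.2 hz⟩
  · rintro ⟨a, b⟩ hz hP
    obtain ⟨h1, h2⟩ := hcut _ hz hP
    rw [ho0, ho0']
    refine ⟨h1, fun h3 => ?_⟩
    by_contra h4
    rcases (not_lt.1 h4).eq_or_lt with h5 | h5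
    · exact huG b (h5 ▸ hz)
    · exact lt_asymm h3 (h2 h5)

/-- The successor of the image of the largest listed point below `u` works: if `a.1 < u` in `Ψ`,
then `s a.1 ≤ u`. Listing `s 0` as well ensures that such a point exists. -/
theorem IsPIso.exists_cut_finset {G : Submodule ℚ (Γ × Γ)} (hG : O.IsPIso G) {u : Γ}
    (hu : u ∈ O.P) (huG : ∀ b, (u, b) ∉ G) (T : Finset (Γ × Γ)) (hT : ∀ z ∈ T, z ∈ G) :
    ∃ u' ∈ O.P, ∀ z ∈ T, z.1 ∈ O.P → (z.1 < u → z.2 < u') ∧ (u < z.1 → u' < z.2) := by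
  classical
  set S := (insert (O.s 0, O.s 0) T).filter fun z => z.1 ∈ O.P ∧ z.1 < u with hS
  have h0 : (O.s 0, O.s 0) ∈ S := Finset.mem_filter.2 ⟨Finset.mem_insert_self _ _, O.s_mem 0,
    lt_of_le_of_ne (O.s_zero_le u hu) (fun h => huG (O.s 0) ((show O.s 0 = u from h) ▸ hG.s_zero_mem))⟩
  obtain ⟨a, ha, hmax⟩ := S.exists_max_image (fun z => z.1) ⟨_, h0⟩
  obtain ⟨ha1, haP, hau⟩ := Finset.mem_filter.1 ha
  have haG : a ∈ G := by
    rcases Finset.mem_insert.1 ha1 with rfl | h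
    · exact hG.s_zero_mem
    · exact hT a h
  refine ⟨O.s a.2, O.s_mem _, fun z hz hzP => ⟨fun h => ?_, fun h => ?_⟩⟩
  · have h1 := hmax z (Finset.mem_filter.2 ⟨Finset.mem_insert_of_mem hz, hzP, h⟩)
    exact (hG.lt_iff (hT z hz) (hG.s_mem haG)).1 (h1.trans_lt (O.lt_s _ haP))
  · refine (hG.lt_iff (hG.s_mem haG) (hT z hz)).1 (lt_of_le_of_lt ?_ h)
    exact O.s_le _ _ haP hu hau

/-- An element of `Ψ` outside of the domain has a counterpart in the corresponding cut. -/
theorem IsPIso.exists_cut {G : Submodule ℚ (Ultrapower Γ × Ultrapower Γ)} [Countable G]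
    (hG : O.germ.IsPIso G) {u : Ultrapower Γ} (hu : u ∈ O.germ.P) (huG : ∀ b, (u, b) ∉ G) :
    ∃ u' ∈ O.germ.P, ∀ z ∈ G, z.1 ∈ O.germ.P →
      (z.1 < u → z.2 < u') ∧ (u < z.1 → u' < z.2) := by
  have hrep : ∀ a : Ultrapower Γ, ∃ f : ℕ → Γ, (f : Ultrapower Γ) = a := fun a =>
    a.inductionOn fun f => ⟨f, rfl⟩
  choose rep hrep using hrep
  have lt_coe : ∀ (a : Ultrapower Γ) (g : ℕ → Γ),
      a < g ↔ ∀ᶠ n in hyperfilter ℕ, rep a n < g n := by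
    intro a g
    conv_lhs => rw [← hrep a]
    exact Germ.coe_lt
  have coe_lt : ∀ (a : Ultrapower Γ) (g : ℕ → Γ),
      g < a ↔ ∀ᶠ n in hyperfilter ℕ, g n < rep a n := by
    intro a g
    conv_lhs => rw [← hrep a]
    exact Germ.coe_lt
  obtain ⟨g, hg⟩ := exists_seq_of_finite_satisfiable (ι := G)
    (fun z n => {t | t ∈ O.P ∧ (z.1.1 ∈ O.germ.P →
      (z.1.1 < u → rep z.1.2 n < t) ∧ (u < z.1.1 → t < rep z.1.2 n))}) (by
    intro T
    classical
    obtain ⟨x', hx', h⟩ := hG.exists_cut_finset hu huG (T.image Subtype.val) (by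
      intro z hz
      obtain ⟨y, -, rfl⟩ := Finset.mem_image.1 hz
      exact y.2)
    induction x' using Germ.inductionOn with | _ g
    have h2 : ∀ᶠ n in hyperfilter ℕ, ∀ z ∈ T, g n ∈ O.P ∧ (z.1.1 ∈ O.germ.P →
        (z.1.1 < u → rep z.1.2 n < g n) ∧ (u < z.1.1 → g n < rep z.1.2 n)) := by
      rw [Filter.eventually_all_finset]
      intro z hz
      refine (coe_mem_germ_P.1 hx').and ?_
      by_cases hzP : z.1.1 ∈ O.germ.P
      · obtain ⟨h3, h4⟩ := h z.1 (Finset.mem_image_of_mem _ hz) hzP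
        by_cases h5 : z.1.1 < u
        · filter_upwards [(lt_coe _ _).1 (h3 h5)] with n hn
          exact fun _ => ⟨fun _ => hn, fun h6 => absurd h6 (lt_asymm h5)⟩
        · by_cases h6 : u < z.1.1
          · filter_upwards [(coe_lt _ _).1 (h4 h6)] with n hn
            exact fun _ => ⟨fun h7 => absurd h7 h5, fun _ => hn⟩
          · exact .of_forall fun n _ => ⟨fun h7 => absurd h7 h5, fun h7 => absurd h7 h6⟩
      · exact .of_forall fun n h7 => absurd h7 hzP
    filter_upwards [h2] with n h3
    exact ⟨g n, h3⟩)
  refine ⟨g, ?_, fun z hz hzP => ⟨fun h => ?_, fun h => ?_⟩⟩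
  · rw [coe_mem_germ_P]
    filter_upwards [hg ⟨0, G.zero_mem⟩] with n hn using hn.1
  · rw [lt_coe]
    filter_upwards [hg ⟨z, hz⟩] with n hn using (hn.2 hzP).1 h
  · rw [coe_lt]
    filter_upwards [hg ⟨z, hz⟩] with n hn using (hn.2 hzP).2 h

theorem IsPIso.injective_fst {G : Submodule ℚ (Γ × Γ)} (hG : O.IsPIso G) :
    Function.Injective fun z : G => z.1.1 :=
  fun a b h => Subtype.ext (hG.eq_of_fst a.2 b.2 h)

theorem isPIso_sSup {c : Set (Submodule ℚ (Γ × Γ))} (hc : IsChain (· ≤ ·) c) (hne : c.Nonempty)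
    (h : ∀ G ∈ c, O.IsPIso G) : O.IsPIso (sSup c) := by
  have hmem : ∀ z, z ∈ sSup c → ∃ G ∈ c, z ∈ G := fun z =>
    (Submodule.mem_sSup_of_directed hne hc.directedOn).1
  have hle : ∀ G ∈ c, G ≤ sSup c := fun G hG => le_sSup hG
  refine ⟨?_, ?_, ?_, ?_⟩
  · intro z hz h0
    obtain ⟨G, hG, hz⟩ := hmem z hz
    obtain ⟨d, hd, h1⟩ := (h G hG).lead z hz h0
    exact ⟨d, hle G hG hd, h1⟩
  · intro z hz
    obtain ⟨G, hG, hz⟩ := hmem z hz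
    obtain ⟨d, hd, h1⟩ := (h G hG).lead_sub z hz
    exact ⟨d, hle G hG hd, h1⟩
  · intro z hz
    obtain ⟨G, hG, hz⟩ := hmem z hz
    exact (h G hG).mem_P z hz
  · intro z hz h1 h2
    obtain ⟨G, hG, hz⟩ := hmem z hz
    exact hle G hG ((h G hG).pred z hz h1 h2)

/-- A countable partial isomorphism of the ultrapower extends to any given element. -/
theorem IsPIso.exists_extension {G : Submodule ℚ (Ultrapower Γ × Ultrapower Γ)} [Countable G]
    (hG : O.germ.IsPIso G) (x : Ultrapower Γ) :
    ∃ H, G ≤ H ∧ Countable H ∧ O.germ.IsPIso H ∧ ∃ x', (x, x') ∈ H := by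
  obtain ⟨D, hDc, hSD, hD⟩ := exists_countable_closed (Γ := Ultrapower Γ)
    (![O.germ.psi, O.germ.s, O.germ.p])
    (S := insert x (Prod.fst '' (G : Set (Ultrapower Γ × Ultrapower Γ))))
    (((Set.countable_coe_iff.1 ‹Countable G›).image _).insert x)
  have hDpsi : ∀ a ∈ D, O.germ.psi a ∈ D := hD 0
  have hDs : ∀ a ∈ D, O.germ.s a ∈ D := hD 1
  have hDp : ∀ a ∈ D, O.germ.p a ∈ D := hD 2
  have hxD : x ∈ D := hSD (Set.mem_insert _ _)
  -- Confining first coordinates to the countable `D` keeps the maximal graph countable, since its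
  -- members are determined by their first coordinates.
  obtain ⟨M, hGM, hM, hmax⟩ := zorn_le_nonempty₀
    {H | O.germ.IsPIso H ∧ ∀ z ∈ H, z.1 ∈ D} (by
      intro c hc hchain y hy
      refine ⟨sSup c, ⟨isPIso_sSup hchain ⟨y, hy⟩ fun G hG => (hc hG).1, fun z hz => ?_⟩,
        fun z hz => le_sSup hz⟩
      obtain ⟨H, hH, hz⟩ := (Submodule.mem_sSup_of_directed ⟨y, hy⟩ hchain.directedOn).1 hz
      exact (hc hH).2 z hz) G
    ⟨hG, fun z hz => hSD (Set.mem_insert_of_mem _ ⟨z, hz, rfl⟩)⟩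
  have hMc : Countable M :=
    (show Function.Injective fun z : M => (⟨z.1.1, hM.2 z.1 z.2⟩ : D) from
      fun a b h => hM.1.injective_fst (congrArg Subtype.val h)).countable
  refine ⟨M, hGM, hMc, hM.1, ?_⟩
  -- By maximality the domain contains all of `Ψ ∩ D`: the orbit of a missing point stays in `D` and
  -- could be adjoined.
  have hP : ∀ u ∈ D, u ∈ O.germ.P → ∃ b, (u, b) ∈ M := by
    intro u huD huP
    by_contra h
    rw [not_exists] at h
    obtain ⟨u', hu', hcut⟩ := hM.1.exists_cut huP h
    obtain ⟨o, o', ho, -, hN⟩ := hM.1.exists_isNewOrbit huP hu' h hcut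
    have hoD : ∀ l, o l ∈ D := by
      intro l
      induction l using Int.induction_on with
      | zero => rwa [ho]
      | succ i ih => rw [← hN.fst.s_eq]; exact hDs _ ih
      | pred i ih => rw [← hN.fst.p_eq]; exact hDp _ ih
    have hle : adjoinOrbit M o o' ≤ M := hmax ⟨hN.isPIso_adjoin hM.1, fun z hz => by
      have h1 : adjoinOrbit M o o' ≤ D.comap (LinearMap.fst ℚ _ _) := by
        refine sup_le (fun z hz => hM.2 z hz) (Submodule.span_le.2 ?_)
        rintro _ ⟨l, rfl⟩
        exact hoD l
      exact h1 hz⟩ (le_adjoinOrbit M o o')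
    exact h _ (ho ▸ hle (orbit_mem_adjoinOrbit M o o' 0))
  -- With `Ψ ∩ D` exhausted, `x` brings no new member of `Ψ`, because the relevant `psi`- and
  -- `s`-values are computed inside `D`.
  by_contra h
  rw [not_exists] at h
  have hne : ∀ z ∈ M, ∀ q : ℚ, q ≠ 0 → ∀ b, (z.1 + q • x, b) ∉ M := by
    intro z hz q hq b hb
    have h1 := M.smul_mem q⁻¹ (M.sub_mem hb hz)
    refine h (q⁻¹ • (b - z.2)) ?_
    convert h1 using 1
    ext
    · simp [smul_smul, inv_mul_cancel₀ hq]
    · simp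
  have hmemD : ∀ z ∈ M, ∀ q : ℚ, z.1 + q • x ∈ D := fun z hz q =>
    D.add_mem (hM.2 z hz) (D.smul_mem q hxD)
  obtain ⟨x', hx'⟩ := hM.1.exists_adjoin (x := x) (by
      intro z hz
      have h1 : x - z.1 ≠ 0 := by
        intro h1
        rw [sub_eq_zero] at h1
        exact h z.2 (h1 ▸ hz)
      obtain ⟨b, hb⟩ := hP (O.germ.psi (x - z.1)) (hDpsi _ (D.sub_mem hxD (hM.2 z hz)))
        (O.germ.psi_mem _ h1)
      exact ⟨_, hb, O.germ.v_of_ne h1⟩) (by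
      intro z hz q hq
      obtain ⟨b, hb⟩ := hP (O.germ.s (z.1 + q • x)) (hDs _ (hmemD z hz q)) (O.germ.s_mem _)
      exact ⟨_, hb, rfl⟩) (by
      intro z hz q hq h1
      obtain ⟨b, hb⟩ := hP _ (hmemD z hz q) h1
      exact hne z hz q hq b hb)
  have hle : M ⊔ Submodule.span ℚ {(x, x')} ≤ M := hmax ⟨hx', fun z hz => by
    have h1 : M ⊔ Submodule.span ℚ {(x, x')} ≤ D.comap (LinearMap.fst ℚ _ _) := by
      refine sup_le (fun z hz => hM.2 z hz) (Submodule.span_le.2 ?_)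
      rintro _ rfl
      exact hxD
    exact h1 hz⟩ le_sup_left
  exact h x' (hle (Submodule.mem_sup_right (Submodule.subset_span rfl)))

end LogOps

/-! ### Models of `T_log` as vector spaces with total operations. -/

/-- A torsion-free divisible abelian group is a vector space over `ℚ`. -/
noncomputable abbrev ratModuleOfDivisible {Γ : Type*} [AddCommGroup Γ] [LinearOrder Γ]
    [IsOrderedAddMonoid Γ] (h : ∀ (n : ℕ+) (γ : Γ), ∃ β : Γ, (n : ℕ) • β = γ) : Module ℚ Γ :=
  (AddEquiv.ofBijective (DivisibleHull.coeAddMonoidHom Γ) ⟨DivisibleHull.coe_injective, fun x => by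
    induction x with | mk m n
    obtain ⟨β, hβ⟩ := h n m
    refine ⟨β, ?_⟩
    change (DivisibleHull.mk β 1) = _
    rw [DivisibleHull.mk_eq_mk]
    exact ⟨1, by simpa [mul_comm] using hβ⟩⟩).module ℚ

namespace AsymptoticCouple

variable {Γ : Type*} [AddCommGroup Γ] [LinearOrder Γ] [IsOrderedAddMonoid Γ]
  (A : AsymptoticCouple Γ) (hA : A.IsTlogModel)

theorem psi_integral (h : A.HasAsymptoticIntegration) (α : Γ) :
    (A.integral h α : Γ) + A.succ h α = α := (h α).choose_spec

/-- Here `a - c` is an integral of `a`, hence the only one. This describes `s` through `psi` without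
mention of integrals. -/
theorem succ_eq (h : A.HasAsymptoticIntegration) {a c : Γ} (hac : a - c ≠ 0)
    (h1 : A.psi ⟨a - c, hac⟩ = c) : A.succ h a = c := by
  have h2 : A.der (A.integral h a) = A.der ⟨a - c, hac⟩ := by
    refine (A.psi_integral h a).trans ?_
    change a = a - c + _
    rw [h1, sub_add_cancel]
  rw [succ, A.der_injective h2, h1]

theorem psi_neg (a : {γ : Γ // γ ≠ 0}) (h : -(a : Γ) ≠ 0) : A.psi ⟨-a, h⟩ = A.psi a := by
  have := A.ac2 a (-1) (by simpa using h)
  simpa using this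

theorem psiTop_zero : A.psiTop ((0 : Γ) : WithTop Γ) = ⊤ := by
  change (if h : (0 : Γ) ≠ 0 then _ else _) = _
  simp

variable [Module ℚ Γ]

open Classical in
/-- The operations of a model of `T_log`. -/
noncomputable def logOps : LogOps Γ where
  -- The value `0` off the natural domain, here and for `p` and `w`, is arbitrary; no law of
  -- `LogOps` depends on it.
  psi a := if h : a ≠ 0 then A.psi ⟨a, h⟩ else 0
  s := A.succ hA.integration
  p c := if h : c ∈ A.Psi ∧ A.succ hA.integration 0 < c then (A.exists_pred hA h).choose else 0
  w c := if h : c ∈ A.Psi then |(h.choose : Γ)| else 0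
  P := A.Psi
  psi_add a b ha hb hab := by
    simp only [ha, hb, hab, ne_eq, not_false_eq_true, dite_true]
    exact A.ac1 ⟨a, ha⟩ ⟨b, hb⟩ hab
  psi_smul q a hq ha := by
    have h1 : q • a ≠ 0 := smul_ne_zero hq ha
    simp only [ha, h1, ne_eq, not_false_eq_true, dite_true]
    -- (AC2) covers only integer multiples, so `q • a` and `a` are compared through their common
    -- multiple `q.num • a`.
    have e : (q.den : ℤ) • (q • a) = q.num • a := by
      rw [← Int.cast_smul_eq_zsmul ℚ, ← Int.cast_smul_eq_zsmul ℚ, smul_smul]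
      congr 1
      rw [mul_comm]
      exact_mod_cast Rat.mul_den_eq_num q
    have h2 : q.num • a ≠ 0 := smul_ne_zero (Rat.num_ne_zero.2 hq) ha
    have h3 := A.ac2 ⟨q • a, h1⟩ q.den (by rw [e]; exact h2)
    have h4 := A.ac2 ⟨a, ha⟩ q.num h2
    rw [← h3, ← h4]
    congr 2
  psi_lt a b ha hb := by
    simp only [ha.ne', hb, ne_eq, not_false_eq_true, dite_true]
    exact A.ac3 ⟨a, ha.ne'⟩ ⟨b, hb⟩ ha
  psi_anti a b ha hab := by
    simp only [ha.ne', (ha.trans_le hab).ne', ne_eq, not_false_eq_true, dite_true]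
    exact hA.htype ⟨a, ha.ne'⟩ ⟨b, (ha.trans_le hab).ne'⟩ ha hab
  s_spec a := by
    have h1 := A.psi_integral hA.integration a
    have h2 : a - A.succ hA.integration a = A.integral hA.integration a := by
      rw [sub_eq_iff_eq_add, h1]
    have h3 : a - A.succ hA.integration a ≠ 0 := h2 ▸ (A.integral hA.integration a).2
    refine ⟨fun h => h3 (sub_eq_zero.2 h), ?_⟩
    simp only [h3, ne_eq, not_false_eq_true, dite_true]
    simp only [h2]
    rfl
  s_unique a c hac := by
    have h : a - c ≠ 0 := sub_ne_zero.2 hac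
    simp only [h, ne_eq, not_false_eq_true, dite_true]
    exact A.succ_eq hA.integration h
  psi_mem a ha := by
    simp only [ha, ne_eq, not_false_eq_true, dite_true]
    exact ⟨_, rfl⟩
  w_spec c hc := by
    have h1 : |(hc.choose : Γ)| ≠ 0 := abs_ne_zero.2 hc.choose.2
    simp only [hc, h1, ne_eq, not_false_eq_true, dite_true]
    refine ⟨abs_pos.2 hc.choose.2, ?_⟩
    rcases abs_choice (hc.choose : Γ) with h2 | h2
    · simp only [h2]
      exact hc.choose_spec
    · simp only [h2]
      exact (A.psi_neg _ _).trans hc.choose_spec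
  s_zero_le c hc := hA.psi_least.2 hc
  lt_s c hc := (hA.immediate_succ c hc).2.1
  s_le c d hc hd hcd := (hA.immediate_succ c hc).2.2 d hd hcd
  p_spec c hc h0 := by
    have h : c ∈ A.Psi ∧ A.succ hA.integration 0 < c := ⟨hc, h0⟩
    rw [dif_pos h]
    exact (A.exists_pred hA h).choose_spec

theorem psiTop_coe {a : Γ} (h : a ≠ 0) :
    A.psiTop (a : WithTop Γ) = ((A.logOps hA).psi a : WithTop Γ) := by
  change (if h : a ≠ 0 then _ else _) = _
  simp [logOps, h]

theorem pTop_coe {a : Γ} (h : a ∈ (A.logOps hA).P ∧ (A.logOps hA).s 0 < a) :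
    A.pTop hA (a : WithTop Γ) = ((A.logOps hA).p a : WithTop Γ) := by
  change a ∈ A.Psi ∧ A.succ hA.integration 0 < a at h
  refine (dif_pos h).trans ?_
  simp only [logOps, dif_pos h]

theorem pTop_coe_of_not {a : Γ} (h : ¬ (a ∈ (A.logOps hA).P ∧ (A.logOps hA).s 0 < a)) :
    A.pTop hA (a : WithTop Γ) = ⊤ := dif_neg h

theorem deltaTop_coe (n : ℕ+) (a : Γ) :
    A.deltaTop hA n (a : WithTop Γ) = (((n : ℚ)⁻¹ • a : Γ) : WithTop Γ) := by
  change (((hA.divisible n a).choose : Γ) : WithTop Γ) = _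
  have h := (hA.divisible n a).choose_spec
  generalize (hA.divisible n a).choose = b at h ⊢
  rw [← h, ← Nat.cast_smul_eq_nsmul ℚ, smul_smul]
  rw [inv_mul_cancel₀ (by exact_mod_cast n.ne_zero), one_smul]

end AsymptoticCouple

/-! ### Sequences in `Γ_∞` that correspond under a partial isomorphism. -/

namespace LogOps

open Filter

theorem eventually_iff_iff {p q : ℕ → Prop} :
    (∀ᶠ n in hyperfilter ℕ, (p n ↔ q n)) ↔
      ((∀ᶠ n in hyperfilter ℕ, p n) ↔ ∀ᶠ n in hyperfilter ℕ, q n) := by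
  refine ⟨eventually_congr, fun h => ?_⟩
  by_cases hp : ∀ᶠ n in hyperfilter ℕ, p n
  · filter_upwards [hp, h.1 hp] with n h1 h2 using iff_of_true h1 h2
  · filter_upwards [Ultrafilter.eventually_not.2 hp, Ultrafilter.eventually_not.2 (mt h.2 hp)]
      with n h1 h2 using iff_of_false h1 h2

section SeqRel

variable {Γ : Type*} [AddCommGroup Γ] [Module ℚ Γ]

/-- Two sequences in `Γ_∞` whose classes in the ultrapower correspond under `G`. -/
def SeqRel (G : Submodule ℚ (Ultrapower Γ × Ultrapower Γ)) (w w' : ℕ → WithTop Γ) : Prop :=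
  (∀ᶠ n in hyperfilter ℕ, w n = ⊤ ∧ w' n = ⊤) ∨
    ∃ g g' : ℕ → Γ, ((g : Ultrapower Γ), (g' : Ultrapower Γ)) ∈ G ∧
      ∀ᶠ n in hyperfilter ℕ, w n = g n ∧ w' n = g' n

variable {G : Submodule ℚ (Ultrapower Γ × Ultrapower Γ)}

theorem SeqRel.of_mem {g g' : ℕ → Γ} (h : ((g : Ultrapower Γ), (g' : Ultrapower Γ)) ∈ G) :
    SeqRel G (fun n => (g n : WithTop Γ)) (fun n => (g' n : WithTop Γ)) :=
  .inr ⟨g, g', h, .of_forall fun _ => ⟨rfl, rfl⟩⟩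

theorem SeqRel.top : SeqRel G (fun _ => ⊤) (fun _ => ⊤) := .inl (.of_forall fun _ => ⟨rfl, rfl⟩)

theorem SeqRel.mono {H : Submodule ℚ (Ultrapower Γ × Ultrapower Γ)} (hGH : G ≤ H)
    {w w' : ℕ → WithTop Γ} (h : SeqRel G w w') : SeqRel H w w' :=
  h.imp_right fun ⟨g, g', h1, h2⟩ => ⟨g, g', hGH h1, h2⟩

theorem SeqRel.symm {w w' : ℕ → WithTop Γ} (h : SeqRel G w w') :
    SeqRel (G.map (LinearEquiv.prodComm ℚ _ _).toLinearMap) w' w :=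
  h.imp (fun h => h.mono fun _ h => h.symm) fun ⟨g, g', h1, h2⟩ =>
    ⟨g', g, mem_map_prodComm.2 h1, h2.mono fun _ h => h.symm⟩

theorem SeqRel.congr {w w' u u' : ℕ → WithTop Γ} (h : SeqRel G w w')
    (hu : ∀ᶠ n in hyperfilter ℕ, u n = w n ∧ u' n = w' n) : SeqRel G u u' := by
  rcases h with h | ⟨g, g', h1, h2⟩
  · left
    filter_upwards [h, hu] with n h3 h4
    rwa [h4.1, h4.2]
  · refine .inr ⟨g, g', h1, ?_⟩
    filter_upwards [h2, hu] with n h3 h4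
    rwa [h4.1, h4.2]

/-- A strict unary operation preserves `SeqRel` if it does so on `Γ`. -/
theorem SeqRel.unary {f : WithTop Γ → WithTop Γ} (hf : f ⊤ = ⊤)
    (h : ∀ g g' : ℕ → Γ, ((g : Ultrapower Γ), (g' : Ultrapower Γ)) ∈ G →
      SeqRel G (fun n => f (g n)) (fun n => f (g' n)))
    {w w' : ℕ → WithTop Γ} (hw : SeqRel G w w') :
    SeqRel G (fun n => f (w n)) (fun n => f (w' n)) := by
  rcases hw with hw | ⟨g, g', h1, h2⟩
  · left
    filter_upwards [hw] with n hn
    rw [hn.1, hn.2, hf]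
    exact ⟨rfl, rfl⟩
  · refine (h g g' h1).congr ?_
    filter_upwards [h2] with n hn
    rw [hn.1, hn.2]
    exact ⟨rfl, rfl⟩

theorem SeqRel.map {f : Γ → Γ}
    (h : ∀ z ∈ G, (Germ.map f z.1, Germ.map f z.2) ∈ G)
    {w w' : ℕ → WithTop Γ} (hw : SeqRel G w w') :
    SeqRel G (fun n => WithTop.map f (w n)) (fun n => WithTop.map f (w' n)) :=
  hw.unary rfl fun g g' hg => SeqRel.of_mem (g := f ∘ g) (g' := f ∘ g') (h _ hg)

theorem SeqRel.add {w w' u u' : ℕ → WithTop Γ} (hw : SeqRel G w w') (hu : SeqRel G u u') :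
    SeqRel G (fun n => w n + u n) (fun n => w' n + u' n) := by
  rcases hw with hw | ⟨g, g', h1, h2⟩
  · left
    filter_upwards [hw] with n hn
    rw [hn.1, hn.2]
    exact ⟨WithTop.top_add _, WithTop.top_add _⟩
  rcases hu with hu | ⟨f, f', h3, h4⟩
  · left
    filter_upwards [hu] with n hn
    rw [hn.1, hn.2]
    exact ⟨WithTop.add_top _, WithTop.add_top _⟩
  · refine .inr ⟨g + f, g' + f', G.add_mem h1 h3, ?_⟩
    filter_upwards [h2, h4] with n h5 h6
    rw [h5.1, h5.2, h6.1, h6.2]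
    exact ⟨rfl, rfl⟩

end SeqRel

variable {Γ : Type*} [AddCommGroup Γ] [LinearOrder Γ] [IsOrderedAddMonoid Γ] [Module ℚ Γ]
  {O : LogOps Γ} {G : Submodule ℚ (Ultrapower Γ × Ultrapower Γ)} (hG : O.germ.IsPIso G)
include hG

theorem SeqRel.lt_iff {w w' u u' : ℕ → WithTop Γ} (hw : SeqRel G w w') (hu : SeqRel G u u') :
    ∀ᶠ n in hyperfilter ℕ, (w n < u n ↔ w' n < u' n) := by
  rcases hw with hw | ⟨g, g', h1, h2⟩
  · filter_upwards [hw] with n hn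
    simp [hn.1, hn.2]
  rcases hu with hu | ⟨f, f', h3, h4⟩
  · filter_upwards [hu, h2] with n hn h5
    simp [hn.1, hn.2, h5.1, h5.2]
  · have h5 := hG.lt_iff h1 h3
    simp only [Germ.coe_lt] at h5
    filter_upwards [eventually_iff_iff.2 h5, h2, h4] with n h5 h6 h7
    rw [h6.1, h6.2, h7.1, h7.2, WithTop.coe_lt_coe, WithTop.coe_lt_coe, h5]

theorem SeqRel.eq_iff {w w' u u' : ℕ → WithTop Γ} (hw : SeqRel G w w') (hu : SeqRel G u u') :
    ∀ᶠ n in hyperfilter ℕ, (w n = u n ↔ w' n = u' n) := by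
  filter_upwards [hw.lt_iff hG hu, hu.lt_iff hG hw] with n h1 h2
  rw [← not_iff_not, ← ne_eq, ← ne_eq, ne_iff_lt_or_gt, ne_iff_lt_or_gt, h1]
  exact or_congr_right h2

/-- This is the "forth" step for `Γ_∞`: a sequence is `⊤` almost everywhere or finite almost
everywhere, and only the second case needs an extension. -/
theorem SeqRel.exists_right [Countable G] (w : ℕ → WithTop Γ) :
    ∃ H, G ≤ H ∧ Countable H ∧ O.germ.IsPIso H ∧ ∃ w', SeqRel H w w' := by
  by_cases h : ∀ᶠ n in hyperfilter ℕ, w n = ⊤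
  · exact ⟨G, le_rfl, ‹_›, hG, fun _ => ⊤, .inl (h.mono fun _ h => ⟨h, rfl⟩)⟩
  · rw [← Ultrafilter.eventually_not] at h
    obtain ⟨H, hGH, hHc, hH, x', hx⟩ :=
      hG.exists_extension ((fun n => (w n).untopD 0 : ℕ → Γ) : Ultrapower Γ)
    induction x' using Germ.inductionOn with | _ g'
    refine ⟨H, hGH, hHc, hH, fun n => g' n, .inr ⟨_, g', hx, ?_⟩⟩
    filter_upwards [h] with n hn
    obtain ⟨a, ha⟩ := WithTop.ne_top_iff_exists.1 hn
    rw [← ha]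
    exact ⟨rfl, rfl⟩

end LogOps

/-! ### Preservation of terms and formulas. -/

namespace AsymptoticCouple

open Filter LogOps FirstOrder

variable {Γ : Type*} [AddCommGroup Γ] [LinearOrder Γ] [IsOrderedAddMonoid Γ] [Module ℚ Γ]
  (A : AsymptoticCouple Γ) (hA : A.IsTlogModel)

section
variable {A hA}
variable {G : Submodule ℚ (Ultrapower Γ × Ultrapower Γ)} (hG : (A.logOps hA).germ.IsPIso G)
include hG

/-- A pair in `G` vanishes in both coordinates or in neither, so the value `⊤` at `0` occurs on both
sides at once. -/
theorem seqRel_psiTop {w w' : ℕ → WithTop Γ} (hw : SeqRel G w w') :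
    SeqRel G (fun n => A.psiTop (w n)) (fun n => A.psiTop (w' n)) := by
  refine hw.unary rfl fun g g' hg => ?_
  by_cases h0 : ((g : Ultrapower Γ), (g' : Ultrapower Γ)) = 0
  · obtain ⟨h1, h2⟩ := Prod.mk_eq_zero.1 h0
    left
    filter_upwards [Germ.coe_eq.1 h1, Germ.coe_eq.1 h2] with n h3 h4
    rw [h3, h4]
    exact ⟨A.psiTop_zero, A.psiTop_zero⟩
  · have h3 := (hG.lead_psi hg h0).ne_fst
    have h4 := (hG.lead_psi hg h0).ne_snd
    refine .inr ⟨_, _, hG.psi_mem hg h0, ?_⟩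
    filter_upwards [germ_ne_iff.1 h3, germ_ne_iff.1 h4] with n h5 h6
    exact ⟨A.psiTop_coe hA h5, A.psiTop_coe hA h6⟩

/-- Membership in `Ψ^{>s0}` transfers along `G`, so either both sides have predecessors or both take
the value `⊤`. -/
theorem seqRel_pTop {w w' : ℕ → WithTop Γ} (hw : SeqRel G w w') :
    SeqRel G (fun n => A.pTop hA (w n)) (fun n => A.pTop hA (w' n)) := by
  refine hw.unary rfl fun g g' hg => ?_
  have key : ∀ f : ℕ → Γ, ((f : Ultrapower Γ) ∈ (A.logOps hA).germ.P ∧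
      (A.logOps hA).germ.s 0 < (f : Ultrapower Γ)) ↔
      ∀ᶠ n in hyperfilter ℕ, f n ∈ (A.logOps hA).P ∧ (A.logOps hA).s 0 < f n := by
    intro f
    rw [eventually_and, coe_mem_germ_P]
    exact and_congr_right fun _ => Germ.coe_lt
  have hiff : ((g : Ultrapower Γ) ∈ (A.logOps hA).germ.P ∧
      (A.logOps hA).germ.s 0 < (g : Ultrapower Γ)) ↔
      ((g' : Ultrapower Γ) ∈ (A.logOps hA).germ.P ∧
      (A.logOps hA).germ.s 0 < (g' : Ultrapower Γ)) :=
    and_congr (hG.mem_P _ hg) (hG.lt_iff hG.s_zero_mem hg)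
  by_cases h : (g : Ultrapower Γ) ∈ (A.logOps hA).germ.P ∧
      (A.logOps hA).germ.s 0 < (g : Ultrapower Γ)
  · refine .inr ⟨_, _, hG.pred _ hg h.1 h.2, ?_⟩
    filter_upwards [(key g).1 h, (key g').1 (hiff.1 h)] with n h1 h2
    exact ⟨A.pTop_coe hA h1, A.pTop_coe hA h2⟩
  · left
    filter_upwards [Ultrafilter.eventually_not.2 (mt (key g).2 h),
      Ultrafilter.eventually_not.2 (mt (key g').2 (mt hiff.2 h))] with n h1 h2
    exact ⟨A.pTop_coe_of_not hA h1, A.pTop_coe_of_not hA h2⟩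

omit hG in
theorem seqRel_deltaTop (m : ℕ+) {w w' : ℕ → WithTop Γ} (hw : SeqRel G w w') :
    SeqRel G (fun n => A.deltaTop hA m (w n)) (fun n => A.deltaTop hA m (w' n)) := by
  refine hw.unary rfl fun g g' hg => .inr ⟨_, _, G.smul_mem ((m : ℚ)⁻¹) hg, ?_⟩
  exact .of_forall fun n => ⟨A.deltaTop_coe hA m _, A.deltaTop_coe hA m _⟩

theorem seqRel_realize_term {α : Type*} (t : Llog.Term α) {v v' : α → ℕ → WithTop Γ}
    (hv : ∀ i, SeqRel G (v i) (v' i)) :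
    letI := A.llogStructure hA
    SeqRel G (fun n => t.realize fun i => v i n) (fun n => t.realize fun i => v' i n) := by
  let := A.llogStructure hA
  induction t with
  | var i => exact hv i
  | func f ts ih =>
    simp only [Language.Term.realize_func]
    change TlogFunc _ at f
    cases f with
    | zero => exact SeqRel.of_mem (g := 0) (g' := 0) G.zero_mem
    | infty => exact SeqRel.top
    | add => exact (ih 0).add (ih 1)
    | neg =>
      refine (ih 0).map (f := fun a => -a) fun z hz => ?_
      obtain ⟨a, b⟩ := z
      induction a, b using Germ.inductionOn₂ with | _ f g
      exact G.neg_mem hz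
    | psi => exact seqRel_psiTop hG (ih 0)
    | s => exact (ih 0).map (f := (A.logOps hA).s) fun z hz => hG.s_mem hz
    | p => exact seqRel_pTop hG (ih 0)
    | delta m => exact seqRel_deltaTop m (ih 0)

end

theorem elim_apply {α β M : Type*} (v : α → ℕ → M) (xs : β → ℕ → M) (n : ℕ) :
    Sum.elim (fun i => v i n) (fun j => xs j n) = fun i => Sum.elim v xs i n := by
  funext i
  cases i <;> rfl

theorem snoc_apply {M : Type*} {k : ℕ} (xs : Fin k → ℕ → M) (w : ℕ → M) (n : ℕ) :
    (fun j => Fin.snoc (α := fun _ => ℕ → M) xs w j n) =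
      Fin.snoc (α := fun _ => M) (fun j => xs j n) (w n) := by
  funext j
  refine Fin.lastCases ?_ (fun i => ?_) j <;> simp

/-- Formulas are eventually preserved along corresponding sequences. -/
theorem eventually_realize_iff {α : Type*} {k : ℕ} (φ : Llog.BoundedFormula α k)
    {G : Submodule ℚ (Ultrapower Γ × Ultrapower Γ)} [Countable G]
    (hG : (A.logOps hA).germ.IsPIso G)
    {v v' : α → ℕ → WithTop Γ} (hv : ∀ i, SeqRel G (v i) (v' i))
    {xs xs' : Fin k → ℕ → WithTop Γ} (hxs : ∀ i, SeqRel G (xs i) (xs' i)) :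
    letI := A.llogStructure hA
    ∀ᶠ n in hyperfilter ℕ, (φ.Realize (fun i => v i n) (fun j => xs j n) ↔
      φ.Realize (fun i => v' i n) (fun j => xs' j n)) := by
  let := A.llogStructure hA
  induction φ generalizing G v v' with
  | falsum => exact .of_forall fun _ => Iff.rfl
  | equal t₁ t₂ =>
    have h := fun i => Sum.rec (motive := fun i => SeqRel G (Sum.elim v xs i) (Sum.elim v' xs' i))
      hv hxs i
    filter_upwards [(seqRel_realize_term hG t₁ h).eq_iff hG (seqRel_realize_term hG t₂ h)]
      with n hn
    simpa only [Language.BoundedFormula.Realize, elim_apply] using hn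
  | rel R ts =>
    have h := fun i => Sum.rec (motive := fun i => SeqRel G (Sum.elim v xs i) (Sum.elim v' xs' i))
      hv hxs i
    change TlogRel _ at R
    cases R
    filter_upwards [(seqRel_realize_term hG (ts 0) h).lt_iff hG (seqRel_realize_term hG (ts 1) h)]
      with n hn
    simp only [Language.BoundedFormula.Realize, elim_apply]
    exact hn
  | imp φ ψ ih₁ ih₂ =>
    filter_upwards [ih₁ hG hv hxs, ih₂ hG hv hxs] with n h1 h2
    rw [Language.BoundedFormula.realize_imp, Language.BoundedFormula.realize_imp, h1, h2]
  | @all k φ ih =>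
    -- By symmetry one implication suffices. If the left side fails, choose counterexamples `w`
    -- coordinatewise; a partner `w'` of `w` in an extension would then violate the universal
    -- statement on the right.
    have key : ∀ (H : Submodule ℚ (Ultrapower Γ × Ultrapower Γ)) [Countable H],
        (A.logOps hA).germ.IsPIso H → ∀ {u u' : α → ℕ → WithTop Γ} {ys ys' : Fin k → ℕ → WithTop Γ},
        (∀ i, SeqRel H (u i) (u' i)) → (∀ i, SeqRel H (ys i) (ys' i)) →
        (∀ᶠ n in hyperfilter ℕ, φ.all.Realize (fun i => u' i n) (fun j => ys' j n)) →
        ∀ᶠ n in hyperfilter ℕ, φ.all.Realize (fun i => u i n) (fun j => ys j n) := by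
      intro H _ hH u u' ys ys' hu hys hall
      by_contra hcon
      rw [← Ultrafilter.eventually_not] at hcon
      have hw : ∀ n, ∃ a, ¬ φ.all.Realize (fun i => u i n) (fun j => ys j n) →
          ¬ φ.Realize (fun i => u i n) (Fin.snoc (fun j => ys j n) a) := by
        intro n
        by_cases h1 : φ.all.Realize (fun i => u i n) (fun j => ys j n)
        · exact ⟨⊤, fun h2 => absurd h1 h2⟩
        · rw [Language.BoundedFormula.realize_all, not_forall] at h1
          exact h1.imp fun a h2 _ => h2
      choose w hw using hw
      obtain ⟨K, hHK, hKc, hK, w', hww'⟩ := SeqRel.exists_right hH w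
      have hsnoc : ∀ i, SeqRel K (Fin.snoc (α := fun _ => ℕ → WithTop Γ) ys w i)
          (Fin.snoc (α := fun _ => ℕ → WithTop Γ) ys' w' i) := by
        intro i
        refine Fin.lastCases ?_ (fun j => ?_) i
        · simpa using hww'
        · simpa using (hys j).mono hHK
      obtain ⟨n, h1, h2, h3⟩ := ((ih hK (fun i => (hu i).mono hHK) hsnoc).and
        (hcon.and hall)).exists
      rw [snoc_apply, snoc_apply] at h1
      exact hw n h2 (h1.2 (Language.BoundedFormula.realize_all.1 h3 _))
    have hswap : Countable (G.map (LinearEquiv.prodComm ℚ _ _).toLinearMap) :=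
      ((Set.countable_coe_iff.1 ‹Countable G›).image _).to_subtype
    exact eventually_iff_iff.2 ⟨key _ hG.symm (fun i => (hv i).symm) (fun i => (hxs i).symm),
      key G hG hv hxs⟩

end AsymptoticCouple

/-! ### The diagonal partial isomorphism and orbits in the ultrapower. -/

namespace LogOps

open Filter

variable {Γ : Type*} [AddCommGroup Γ] [LinearOrder Γ] [IsOrderedAddMonoid Γ] [Module ℚ Γ]
  {O : LogOps Γ}

theorem IsOrbit.ext {o o' : ℤ → Γ} (h : O.IsOrbit o) (h' : O.IsOrbit o') (h0 : o 0 = o' 0) :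
    o = o' := by
  funext l
  induction l using Int.induction_on with
  | zero => exact h0
  | succ i ih => rw [← h.s_eq, ← h'.s_eq, ih]
  | pred i ih => rw [← h.p_eq, ← h'.p_eq, ih]

omit [LinearOrder Γ] [IsOrderedAddMonoid Γ] in
theorem countable_adjoinOrbit {G : Submodule ℚ (Γ × Γ)} [Countable G] (o o' : ℤ → Γ) :
    Countable (adjoinOrbit G o o') := by
  have h1 : (G : Set (Γ × Γ)).Countable := ‹Countable G›
  have h2 : ((Submodule.span ℚ (Set.range fun l => (o l, o' l)) : Submodule ℚ (Γ × Γ)) :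
      Set (Γ × Γ)).Countable :=
    (inferInstance : Countable (Submodule.span ℚ (Set.range fun l => (o l, o' l))))
  refine ((h1.prod h2).image fun y => y.1 + y.2).mono ?_
  intro z hz
  obtain ⟨y, hy, t, ht, rfl⟩ := Submodule.mem_sup.1 hz
  exact ⟨(y, t), ⟨hy, ht⟩, rfl⟩

/-- The graph of the diagonal embedding of a subspace into the ultrapower. -/
noncomputable def diag (D : Submodule ℚ Γ) : Submodule ℚ (Ultrapower Γ × Ultrapower Γ) :=
  D.map
    ({ toFun := fun a => ((a : Ultrapower Γ), (a : Ultrapower Γ))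
       map_add' := fun _ _ => rfl
       map_smul' := fun _ _ => rfl } : Γ →ₗ[ℚ] Ultrapower Γ × Ultrapower Γ)

omit [LinearOrder Γ] [IsOrderedAddMonoid Γ] in
theorem mem_diag {D : Submodule ℚ Γ} {z : Ultrapower Γ × Ultrapower Γ} :
    z ∈ diag D ↔ ∃ a ∈ D, z = ((a : Ultrapower Γ), (a : Ultrapower Γ)) :=
  ⟨fun ⟨a, h1, h2⟩ => ⟨a, h1, h2.symm⟩, fun ⟨a, h1, h2⟩ => ⟨a, h1, h2.symm⟩⟩

omit [LinearOrder Γ] [IsOrderedAddMonoid Γ] in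
theorem countable_diag (D : Submodule ℚ Γ) [Countable D] : Countable (diag D) :=
  ((Set.countable_coe_iff.1 ‹Countable D›).image _).to_subtype

theorem germ_v_const {a c : Γ} (h : O.v a = c) :
    O.germ.v (a : Ultrapower Γ) = ((c : Ultrapower Γ) : WithTop (Ultrapower Γ)) :=
  germ_v_coe (f := fun _ => a) (g := fun _ => c) |>.2 (.of_forall fun _ => h)

theorem isPIso_diag {D : Submodule ℚ Γ} (hpsi : ∀ a ∈ D, O.psi a ∈ D)
    (hs : ∀ a ∈ D, O.s a ∈ D) (hp : ∀ a ∈ D, O.p a ∈ D) : O.germ.IsPIso (diag D) where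
  lead z hz h0 := by
    obtain ⟨a, ha, rfl⟩ := mem_diag.1 hz
    have h1 : a ≠ 0 := by rintro rfl; exact h0 rfl
    exact ⟨_, mem_diag.2 ⟨_, hpsi a ha, rfl⟩, germ_v_const (O.v_of_ne h1),
      germ_v_const (O.v_of_ne h1), Iff.rfl⟩
  lead_sub z hz := by
    obtain ⟨a, ha, rfl⟩ := mem_diag.1 hz
    exact ⟨_, mem_diag.2 ⟨_, hs a ha, rfl⟩, germ_v_const (O.v_sub_s a),
      germ_v_const (O.v_sub_s a), Iff.rfl⟩
  mem_P z hz := by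
    obtain ⟨a, ha, rfl⟩ := mem_diag.1 hz
    exact Iff.rfl
  pred z hz _ _ := by
    obtain ⟨a, ha, rfl⟩ := mem_diag.1 hz
    exact mem_diag.2 ⟨_, hp a ha, rfl⟩

end LogOps

namespace AsymptoticCouple

open Filter LogOps FirstOrder

variable {Γ : Type*} [AddCommGroup Γ] [LinearOrder Γ] [IsOrderedAddMonoid Γ]
  (A : AsymptoticCouple Γ)

/-- The graph of `F : Ψ → Ψ` as a relation on `Γ_∞`. -/
def graphRel (F : A.Psi → A.Psi) (a b : WithTop Γ) : Prop :=
  ∃ x : A.Psi, a = ((x : Γ) : WithTop Γ) ∧ b = ((F x : Γ) : WithTop Γ)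

variable (hA : A.IsTlogModel)

/-- The candidate pieces: powers of `s`, and constants. -/
noncomputable def pieceVal : ℤ ⊕ A.Psi → WithTop Γ → WithTop Γ
  | .inl l => A.sPow hA l
  | .inr c => fun _ => ((c : Γ) : WithTop Γ)

/-- `F` agrees with the candidate `f` on `[lo, hi)`. -/
def IsPiece (F : A.Psi → A.Psi) (lo : A.Psi) (hi : Option A.Psi) (f : ℤ ⊕ A.Psi) : Prop :=
  ∀ x : A.Psi, lo ≤ x → (∀ c ∈ hi, x < c) →
    ((F x : Γ) : WithTop Γ) = A.pieceVal hA f ((x : Γ) : WithTop Γ)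

variable [Module ℚ Γ]

variable {A hA}

theorem seqRel_sPow {G : Submodule ℚ (Ultrapower Γ × Ultrapower Γ)}
    (hG : (A.logOps hA).germ.IsPIso G) (l : ℤ) {w w' : ℕ → WithTop Γ} (hw : SeqRel G w w') :
    SeqRel G (fun n => A.sPow hA l (w n)) (fun n => A.sPow hA l (w' n)) := by
  have iter : ∀ (f : WithTop Γ → WithTop Γ), (∀ {u u' : ℕ → WithTop Γ}, SeqRel G u u' →
      SeqRel G (fun n => f (u n)) (fun n => f (u' n))) → ∀ k : ℕ,
      SeqRel G (fun n => f^[k] (w n)) (fun n => f^[k] (w' n)) := by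
    intro f hf k
    induction k with
    | zero => exact hw
    | succ k ih =>
      simp only [Function.iterate_succ_apply']
      exact hf ih
  rcases l with k | k
  · exact iter _ (fun hu => hu.map (f := (A.logOps hA).s) fun z hz => hG.s_mem hz) k
  · exact iter _ (fun hu => seqRel_pTop hG hu) (k + 1)

/-- Every member of an orbit is itself a successor, hence lies in `Ψ^{>s0}` at almost all
coordinates; there `pTop` agrees with `p`. -/
theorem exists_sPow_eq {o : ℤ → Ultrapower Γ} (ho : (A.logOps hA).germ.IsOrbit o) {x : ℕ → Γ}
    (hx : o 0 = x) (l : ℤ) : ∃ g : ℕ → Γ, o l = g ∧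
      ∀ᶠ n in hyperfilter ℕ, A.sPow hA l (x n : WithTop Γ) = g n := by
  have neg : ∀ k : ℕ, ∃ g : ℕ → Γ, o (-k) = g ∧
      ∀ᶠ n in hyperfilter ℕ, (A.pTop hA)^[k] (x n : WithTop Γ) = g n := by
    intro k
    induction k with
    | zero => exact ⟨x, by simpa using hx, .of_forall fun _ => rfl⟩
    | succ k ih =>
      obtain ⟨g, h1, h2⟩ := ih
      refine ⟨(A.logOps hA).p ∘ g, ?_, ?_⟩
      · have h3 := ho.p_eq (-k)
        rw [h1] at h3
        rw [Nat.cast_succ, neg_add, ← sub_eq_add_neg, ← h3]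
        rfl
      · have h3 : (g : Ultrapower Γ) ∈ (A.logOps hA).germ.P := h1 ▸ ho.mem _
        have h4 : (A.logOps hA).germ.s 0 < (g : Ultrapower Γ) := by
          rw [← h1, ← sub_add_cancel (-(k : ℤ)) 1, ← ho.s_eq]
          exact (A.logOps hA).germ.s_zero_lt_s (ho.mem _)
        filter_upwards [h2, coe_mem_germ_P.1 h3, Germ.coe_lt.1 h4] with n h2 h3 h4
        rw [Function.iterate_succ_apply', h2]
        exact A.pTop_coe hA ⟨h3, h4⟩
  rcases l with k | k
  · change ∃ g : ℕ → Γ, o k = g ∧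
      ∀ᶠ n in hyperfilter ℕ, (A.sTop hA)^[k] (x n : WithTop Γ) = g n
    induction k with
    | zero => exact ⟨x, hx, .of_forall fun _ => rfl⟩
    | succ k ih =>
      obtain ⟨g, h1, h2⟩ := ih
      refine ⟨(A.logOps hA).s ∘ g, ?_, ?_⟩
      · rw [Nat.cast_succ, ← ho.s_eq, h1]
        rfl
      · filter_upwards [h2] with n h2
        rw [Function.iterate_succ_apply', h2]
        rfl
  · exact neg (k + 1)

/-- The graph of a definable function is eventually preserved along corresponding sequences. -/
theorem eventually_graphRel {F : A.Psi → A.Psi} {A₀ : Finset (WithTop Γ)}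
    {φ : Llog.Formula ((A₀ : Set (WithTop Γ)) ⊕ Fin 2)}
    (hφ : letI := A.llogStructure hA
      ∀ v : Fin 2 → WithTop Γ, A.graphRel F (v 0) (v 1) ↔ φ.Realize (Sum.elim (↑) v))
    {D : Submodule ℚ Γ} (hD : ∀ a : Γ, (a : WithTop Γ) ∈ A₀ → a ∈ D)
    {G : Submodule ℚ (Ultrapower Γ × Ultrapower Γ)} [Countable G]
    (hG : (A.logOps hA).germ.IsPIso G) (hDG : diag D ≤ G) {w w' u u' : ℕ → WithTop Γ}
    (hw : SeqRel G w w') (hu : SeqRel G u u')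
    (h : ∀ᶠ n in hyperfilter ℕ, A.graphRel F (w n) (u n)) :
    ∀ᶠ n in hyperfilter ℕ, A.graphRel F (w' n) (u' n) := by
  let := A.llogStructure hA
  let v : (A₀ : Set (WithTop Γ)) ⊕ Fin 2 → ℕ → WithTop Γ :=
    Sum.elim (fun c _ => c) ![w, u]
  let v' : (A₀ : Set (WithTop Γ)) ⊕ Fin 2 → ℕ → WithTop Γ :=
    Sum.elim (fun c _ => c) ![w', u']
  have hv : ∀ i, SeqRel G (v i) (v' i) := by
    rintro (⟨c, hc⟩ | i)
    · change SeqRel G (fun _ => c) (fun _ => c)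
      induction c with
      | top => exact .top
      | coe a => exact .of_mem (hDG (mem_diag.2 ⟨a, hD a hc, rfl⟩))
    · fin_cases i
      · exact hw
      · exact hu
  have key := eventually_realize_iff A hA φ hG hv (xs := default) (xs' := default)
    (fun i => i.elim0)
  filter_upwards [h, key] with n h1 h2
  have e : ∀ a b : ℕ → WithTop Γ, (fun i => (Sum.elim (fun c _ => c) ![a, b] :
      (A₀ : Set (WithTop Γ)) ⊕ Fin 2 → ℕ → WithTop Γ) i n) = Sum.elim (↑) ![a n, b n] := by
    intro a b
    funext i
    rcases i with c | i
    · rfl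
    · fin_cases i <;> rfl
  have hxs : ∀ (v : (A₀ : Set (WithTop Γ)) ⊕ Fin 2 → WithTop Γ) (xs : Fin 0 → WithTop Γ),
      φ.Realize v ↔ Language.BoundedFormula.Realize φ v xs := by
    intro v xs
    rw [Language.Formula.Realize]
    exact iff_of_eq (congrArg _ (Subsingleton.elim _ _))
  rw [e w u, e w' u'] at h2
  exact (hφ ![w' n, u' n]).2 ((hxs _ _).2 (h2.1 ((hxs _ _).1 ((hφ ![w n, u n]).1 h1))))

end AsymptoticCouple

/-! ### Definable functions at generic points. -/

namespace AsymptoticCouple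

open Filter LogOps FirstOrder

variable {Γ : Type*} [AddCommGroup Γ] [LinearOrder Γ] [IsOrderedAddMonoid Γ] [Module ℚ Γ]
  {A : AsymptoticCouple Γ} {hA : A.IsTlogModel}

omit [LinearOrder Γ] [IsOrderedAddMonoid Γ] in
theorem countable_subtype_mem {S : Set Γ} (D : Submodule ℚ Γ) [Countable D] :
    Countable {c : S // (c : Γ) ∈ D} :=
  (show Function.Injective fun c : {c : S // (c : Γ) ∈ D} => (⟨c.1, c.2⟩ : D) from fun _ _ h =>
    Subtype.ext (Subtype.ext (Subtype.mk.inj h))).countable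

/-- The value of `F` at a generic point of a cut in `D` is not given by a candidate over `D`
that fails on every interval containing the cut. -/
theorem not_eventually_eq_pieceVal {F : A.Psi → A.Psi} {A₀ : Finset (WithTop Γ)}
    {φ : Llog.Formula ((A₀ : Set (WithTop Γ)) ⊕ Fin 2)}
    (hφ : letI := A.llogStructure hA
      ∀ v : Fin 2 → WithTop Γ, A.graphRel F (v 0) (v 1) ↔ φ.Realize (Sum.elim (↑) v))
    {D : Submodule ℚ Γ} [Countable D] (hD : ∀ a : Γ, (a : WithTop Γ) ∈ A₀ → a ∈ D)
    (hG : (A.logOps hA).germ.IsPIso (diag D)) {x : ℕ → A.Psi}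
    (hxD : ∀ b, ((((fun n => (x n : Γ)) : ℕ → Γ) : Ultrapower Γ), b) ∉ diag D) {f : ℤ ⊕ A.Psi}
    (hf : ∀ c, f = .inr c → (c : Γ) ∈ D)
    (hx : ∀ lo : A.Psi, (lo : Γ) ∈ D → ∀ hi : Option A.Psi, (∀ c ∈ hi, (c : Γ) ∈ D) →
      ∀ᶠ n in hyperfilter ℕ, ¬ (lo ≤ x n ∧ (∀ c ∈ hi, x n < c) ∧ A.IsPiece hA F lo hi f)) :
    ¬ ∀ᶠ n in hyperfilter ℕ, ((F (x n) : Γ) : WithTop Γ) =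
      A.pieceVal hA f ((x n : Γ) : WithTop Γ) := by
  intro hFx
  set O := A.logOps hA with hO
  set X : ℕ → Γ := fun n => (x n : Γ) with hX
  have hXP : (X : Ultrapower Γ) ∈ O.germ.P := coe_mem_germ_P.2 (.of_forall fun n => (x n).2)
  have hs0D : O.s 0 ∈ D := by
    obtain ⟨a, ha, h⟩ := mem_diag.1 hG.s_zero_mem
    have h1 : O.s 0 = a := Germ.const_inj.1 (Prod.mk.inj h).1
    exact h1 ▸ ha
  have hsD : ∀ a ∈ D, O.s a ∈ D := by
    intro a ha
    obtain ⟨b, hb, h⟩ := mem_diag.1 (hG.s_mem (mem_diag.2 ⟨a, ha, rfl⟩))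
    have h1 : O.s a = b := Germ.const_inj.1 (Prod.mk.inj h).1
    exact h1 ▸ hb
  have hne : ∀ c ∈ D, (c : Ultrapower Γ) ≠ X := fun c hc h =>
    hxD c (mem_diag.2 ⟨c, hc, by rw [← h]⟩)
  let B := {c : A.Psi // (c : Γ) ∈ D}
  have hB : Countable B := countable_subtype_mem D
  let s₀ : A.Psi := ⟨O.s 0, O.s_mem 0⟩
  have : Nonempty A.Psi := ⟨s₀⟩
  -- Saturation yields `z` in the cut of `x` over `D` at which the candidate fails. The conditions
  -- do not vary with the coordinate, so one `t` serves all of them.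
  obtain ⟨z, hz⟩ := exists_seq_of_finite_satisfiable (Γ := A.Psi) (ι := Option B)
    (fun i n => match i with
      | none => {t | ((F t : Γ) : WithTop Γ) ≠ A.pieceVal hA f ((t : Γ) : WithTop Γ)}
      | some c => {t | (((c.1 : Γ) : Ultrapower Γ) < X → c.1 ≤ t) ∧
          ((X : Ultrapower Γ) < ((c.1 : Γ) : Ultrapower Γ) → t < c.1)}) (by
    intro T
    classical
    let T' : Finset B := T.eraseNone
    let b₀ : B := ⟨s₀, hs0D⟩
    obtain ⟨lo, hlo, hlomax⟩ := Finset.exists_max_image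
      ((insert b₀ T').filter fun c => ((c.1 : Γ) : Ultrapower Γ) < X) (fun c => c.1)
      ⟨b₀, Finset.mem_filter.2 ⟨Finset.mem_insert_self _ _,
        lt_of_le_of_ne (show ((O.s 0 : Γ) : Ultrapower Γ) ≤ X from O.germ.s_zero_le _ hXP)
          (hne _ hs0D)⟩⟩
    have hhi : ∃ hi : Option B, (∀ c ∈ hi, (X : Ultrapower Γ) < ((c.1 : Γ) : Ultrapower Γ)) ∧
        ∀ c ∈ T', (X : Ultrapower Γ) < ((c.1 : Γ) : Ultrapower Γ) → ∃ d ∈ hi, d.1 ≤ c.1 := by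
      rcases (T'.filter fun c => (X : Ultrapower Γ) <
        ((c.1 : Γ) : Ultrapower Γ)).eq_empty_or_nonempty with h | h
      · exact ⟨none, by simp, fun c hc hXc => absurd hXc (Finset.filter_eq_empty_iff.1 h hc)⟩
      · obtain ⟨d, hd, hmin⟩ := Finset.exists_min_image _ (fun c : B => c.1) h
        refine ⟨some d, ?_, fun c hc hXc => ⟨d, rfl, hmin c (Finset.mem_filter.2 ⟨hc, hXc⟩)⟩⟩
        rintro c ⟨⟩
        exact (Finset.mem_filter.1 hd).2
    obtain ⟨hi, hhi1, hhi2⟩ := hhi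
    have h1 : ∀ᶠ n in hyperfilter ℕ, lo.1 ≤ x n := by
      filter_upwards [Germ.coe_lt.1 (Finset.mem_filter.1 hlo).2] with n hn using hn.le
    have h2 : ∀ᶠ n in hyperfilter ℕ, ∀ c ∈ hi.map Subtype.val, x n < c := by
      rcases hi with _ | c
      · exact .of_forall fun n c hc => by simp at hc
      · filter_upwards [Germ.coe_lt.1 (hhi1 c rfl)] with n hn
        rintro _ ⟨⟩
        exact hn
    have h3 := hx lo.1 lo.2 (hi.map Subtype.val) (by
      intro c hc
      obtain ⟨d, -, rfl⟩ := Option.mem_map.1 hc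
      exact d.2)
    obtain ⟨n, h1, h2, h3⟩ := (h1.and (h2.and h3)).exists
    have h4 : ¬ A.IsPiece hA F lo.1 (hi.map Subtype.val) f := fun h => h3 ⟨h1, h2, h⟩
    rw [IsPiece] at h4
    push Not at h4
    obtain ⟨t, ht1, ht2, ht3⟩ := h4
    refine .of_forall fun n => ⟨t, fun i hi => ?_⟩
    rcases i with _ | c
    · exact ht3
    · have hc : c ∈ T' := Finset.mem_eraseNone.2 hi
      refine ⟨fun h => (hlomax c (Finset.mem_filter.2
        ⟨Finset.mem_insert_of_mem hc, h⟩)).trans ht1, fun h => ?_⟩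
      obtain ⟨d, hd, hdc⟩ := hhi2 c hc h
      exact (ht2 d.1 (Option.mem_map.2 ⟨d, hd, rfl⟩)).trans_le hdc)
  set Z : ℕ → Γ := fun n => (z n : Γ) with hZ
  have hZP : (Z : Ultrapower Γ) ∈ O.germ.P := coe_mem_germ_P.2 (.of_forall fun n => (z n).2)
  have hcut : ∀ y ∈ diag D, y.1 ∈ O.germ.P →
      (y.1 < (X : Ultrapower Γ) → y.2 < (Z : Ultrapower Γ)) ∧
      ((X : Ultrapower Γ) < y.1 → (Z : Ultrapower Γ) < y.2) := by
    intro y hy hyP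
    obtain ⟨a, ha, rfl⟩ := mem_diag.1 hy
    have haP : a ∈ O.P := Germ.liftPred_const_iff.1 hyP
    refine ⟨fun h => ?_, fun h => ?_⟩
    -- From below only weak inequalities were imposed; using the one for `s a`, which is in `D` and
    -- also below `x`, makes that for `a` strict.
    · have h1 : ((O.s a : Γ) : Ultrapower Γ) < X :=
        lt_of_le_of_ne (O.germ.s_le _ _ hyP hXP h) (hne _ (hsD a ha))
      refine (O.germ.lt_s _ hyP).trans_le (Germ.coe_le.2 ?_)
      filter_upwards [hz (some ⟨⟨O.s a, O.s_mem a⟩, hsD a ha⟩)] with n hn using hn.1 h1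
    · refine Germ.coe_lt.2 ?_
      filter_upwards [hz (some ⟨⟨a, haP⟩, ha⟩)] with n hn using hn.2 h
  have := countable_diag D
  obtain ⟨o, o', ho, ho', hN⟩ := hG.exists_isNewOrbit hXP hZP hxD hcut
  have := countable_adjoinOrbit (G := diag D) o o'
  have hG' := hN.isPIso_adjoin hG
  have hXZ : SeqRel (adjoinOrbit (diag D) o o') (fun n => (X n : WithTop Γ))
      (fun n => (Z n : WithTop Γ)) := by
    have := orbit_mem_adjoinOrbit (diag D) o o' 0
    rw [ho, ho'] at this
    exact .of_mem this
  have hval : SeqRel (adjoinOrbit (diag D) o o') (fun n => A.pieceVal hA f (X n : WithTop Γ))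
      (fun n => A.pieceVal hA f (Z n : WithTop Γ)) := by
    rcases f with l | c
    · exact seqRel_sPow hG' l hXZ
    · exact .of_mem (g := fun _ => (c : Γ)) (g' := fun _ => (c : Γ))
        (le_adjoinOrbit _ o o' (mem_diag.2 ⟨c, hf c rfl, rfl⟩))
  -- The map sending `x` to `z` over `D` carries the candidate value at `x` to the one at `z`, so
  -- the latter would be `F z`.
  have key := eventually_graphRel hφ hD hG' (le_adjoinOrbit _ o o') hXZ hval (by
    filter_upwards [hFx] with n hn using ⟨x n, rfl, hn.symm⟩)
  obtain ⟨n, ⟨t, h1, h2⟩, h3⟩ := (key.and (hz none)).exists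
  have h4 : z n = t := Subtype.ext (WithTop.coe_injective h1)
  exact h3 (by rw [h4]; rw [← h2, hZ, ← h4])

/-- The value of `F` at a generic point is a power of `s` of that point, or comes from `D`. -/
theorem exists_eventually_eq_pieceVal {F : A.Psi → A.Psi} {A₀ : Finset (WithTop Γ)}
    {φ : Llog.Formula ((A₀ : Set (WithTop Γ)) ⊕ Fin 2)}
    (hφ : letI := A.llogStructure hA
      ∀ v : Fin 2 → WithTop Γ, A.graphRel F (v 0) (v 1) ↔ φ.Realize (Sum.elim (↑) v))
    {D : Submodule ℚ Γ} [Countable D] (hD : ∀ a : Γ, (a : WithTop Γ) ∈ A₀ → a ∈ D)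
    (hG : (A.logOps hA).germ.IsPIso (diag D)) {x : ℕ → A.Psi}
    (hxD : ∀ b, ((((fun n => (x n : Γ)) : ℕ → Γ) : Ultrapower Γ), b) ∉ diag D) :
    ∃ f : ℤ ⊕ A.Psi, (∀ c, f = .inr c → (c : Γ) ∈ D) ∧
      ∀ᶠ n in hyperfilter ℕ, ((F (x n) : Γ) : WithTop Γ) =
        A.pieceVal hA f ((x n : Γ) : WithTop Γ) := by
  by_contra hcon
  set O := A.logOps hA with hO
  set X : ℕ → Γ := fun n => (x n : Γ) with hX
  set Y : ℕ → Γ := fun n => (F (x n) : Γ) with hY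
  have hXP : (X : Ultrapower Γ) ∈ O.germ.P := coe_mem_germ_P.2 (.of_forall fun n => (x n).2)
  have hYP : (Y : Ultrapower Γ) ∈ O.germ.P := coe_mem_germ_P.2 (.of_forall fun n => (F (x n)).2)
  have := countable_diag D
  obtain ⟨o, o', ho, ho', hN⟩ := hG.exists_isNewOrbit hXP hXP hxD (by
    intro z hz _
    obtain ⟨a, ha, rfl⟩ := mem_diag.1 hz
    exact ⟨id, id⟩)
  obtain rfl : o = o' := hN.fst.ext hN.snd (ho.trans ho'.symm)
  have := countable_adjoinOrbit (G := diag D) o o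
  have hG' := hN.isPIso_adjoin hG
  have hdiag : ∀ z ∈ adjoinOrbit (diag D) o o, z.1 = z.2 := by
    have h : adjoinOrbit (diag D) o o ≤
        LinearMap.eqLocus (LinearMap.fst ℚ _ _) (LinearMap.snd ℚ _ _) := by
      refine sup_le ?_ (Submodule.span_le.2 ?_)
      · intro z hz
        obtain ⟨a, ha, rfl⟩ := mem_diag.1 hz
        rfl
      · rintro _ ⟨l, rfl⟩
        rfl
    exact fun z hz => h hz
  -- A member of `Ψ` in this domain comes from `D` or from the orbit of `x`, and both would give the
  -- excluded description of `F x`.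
  have hYG : ∀ b, ((Y : Ultrapower Γ), b) ∉ adjoinOrbit (diag D) o o := by
    intro b hb
    rcases hN.mem_or_eq hG hb hYP with h | ⟨l, h⟩
    · obtain ⟨d, hd, h1⟩ := mem_diag.1 h
      have h2 : (Y : Ultrapower Γ) = d := (Prod.mk.inj h1).1
      have h3 : ∀ᶠ n in hyperfilter ℕ, Y n = d := Germ.coe_eq.1 h2
      obtain ⟨n, hn⟩ := h3.exists
      refine hcon ⟨.inr ⟨d, hn ▸ (F (x n)).2⟩, fun c hc => ?_, ?_⟩
      · rw [← Sum.inr.inj hc]; exact hd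
      · filter_upwards [h3] with n hn using congrArg _ hn
    · obtain ⟨g, hg1, hg2⟩ := exists_sPow_eq hN.fst ho l
      have h2 : (Y : Ultrapower Γ) = g := (Prod.mk.inj h).1.trans hg1
      refine hcon ⟨.inl l, fun c hc => by simp at hc, ?_⟩
      filter_upwards [hg2, Germ.coe_eq.1 h2] with n h3 h4
      exact (congrArg _ h4).trans h3.symm
  -- `Y` and `s Y` fill the same cut: were `s Y` in the domain, its predecessor `Y` would be too.
  -- Moving `Y` to `s Y` while fixing `x` then contradicts that `F` is a function.
  obtain ⟨e, e', he, he', hN'⟩ := hG'.exists_isNewOrbit hYP (O.germ.s_mem Y) hYG (by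
    intro z hz hzP
    rw [← hdiag z hz]
    refine ⟨fun h => h.trans (O.germ.lt_s _ hYP), fun h => ?_⟩
    refine lt_of_le_of_ne (O.germ.s_le _ _ hYP hzP h) fun h1 => ?_
    obtain ⟨b, -, -, hb⟩ := hG'.mem_of_s_eq_fst hz hYP h1
    exact hYG b hb)
  have := countable_adjoinOrbit (G := adjoinOrbit (diag D) o o) e e'
  have hle := le_adjoinOrbit (adjoinOrbit (diag D) o o) e e'
  have h1 := orbit_mem_adjoinOrbit (diag D) o o 0
  have h2 := orbit_mem_adjoinOrbit (adjoinOrbit (diag D) o o) e e' 0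
  rw [ho] at h1
  rw [he, he'] at h2
  have key := eventually_graphRel hφ hD (hN'.isPIso_adjoin hG')
    ((le_adjoinOrbit (diag D) o o).trans hle) (SeqRel.of_mem (hle h1))
    (SeqRel.of_mem (g' := O.s ∘ Y) h2) (.of_forall fun n => ⟨x n, rfl, rfl⟩)
  obtain ⟨n, t, h3, h4⟩ := key.exists
  have h5 : x n = t := Subtype.ext (WithTop.coe_injective h3)
  have h6 : O.s (Y n) = F t := WithTop.coe_injective h4
  rw [← h5] at h6
  exact (O.lt_s _ (F (x n)).2).ne' h6

/-- Finitely many pieces suffice for a definable function. -/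
theorem exists_finite_pieces {F : A.Psi → A.Psi} (hF : A.IsDefinableFun hA F) :
    ∃ T : Finset (A.Psi × Option A.Psi × (ℤ ⊕ A.Psi)), ∀ x : A.Psi, ∃ d ∈ T,
      d.1 ≤ x ∧ (∀ c ∈ d.2.1, x < c) ∧ A.IsPiece hA F d.1 d.2.1 d.2.2 := by
  classical
  set O := A.logOps hA with hO
  obtain ⟨A₀, φ, hφ⟩ : ∃ (A₀ : Finset (WithTop Γ))
      (φ : Llog.Formula ((A₀ : Set (WithTop Γ)) ⊕ Fin 2)), letI := A.llogStructure hA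
      ∀ v : Fin 2 → WithTop Γ, A.graphRel F (v 0) (v 1) ↔ φ.Realize (Sum.elim (↑) v) := by
    let := A.llogStructure hA
    obtain ⟨A₀, -, h⟩ := Set.definable_iff_finitely_definable.1 hF
    obtain ⟨φ, hφ⟩ := Set.definable_iff_exists_formula_sum.1 h
    exact ⟨A₀, φ, fun v => Set.ext_iff.1 hφ v⟩
  -- Closure under `F` makes the constant `F a`, for `a` in `Ψ ∩ D`, a candidate over `D`.
  obtain ⟨D, hDc, hSD, hcl⟩ := exists_countable_closed (Γ := Γ)
    (![O.psi, O.s, O.p, fun a => if h : a ∈ A.Psi then (F ⟨a, h⟩ : Γ) else 0])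
    (S := {a | (a : WithTop Γ) ∈ A₀})
    ((A₀.finite_toSet.preimage WithTop.coe_injective.injOn).countable)
  have hFD : ∀ c : A.Psi, (c : Γ) ∈ D → (F c : Γ) ∈ D := by
    intro c hc
    have h : (if h : (c : Γ) ∈ A.Psi then (F ⟨c, h⟩ : Γ) else 0) ∈ D := hcl 3 c hc
    rwa [dif_pos c.2] at h
  have hsD : ∀ a ∈ D, O.s a ∈ D := hcl 1
  have hG : O.germ.IsPIso (diag D) := isPIso_diag (hcl 0) hsD (hcl 2)
  by_contra hcon
  push Not at hcon
  let B := {c : A.Psi // (c : Γ) ∈ D}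
  have hB : Countable B := countable_subtype_mem D
  let toData : B × Option B × (ℤ ⊕ B) → A.Psi × Option A.Psi × (ℤ ⊕ A.Psi) := fun d =>
    (d.1.1, d.2.1.map Subtype.val, d.2.2.map id Subtype.val)
  have : Nonempty A.Psi := ⟨⟨O.s 0, O.s_mem 0⟩⟩
  obtain ⟨x, hx⟩ := exists_seq_of_finite_satisfiable (Γ := A.Psi) (ι := B × Option B × (ℤ ⊕ B))
    (fun d _ => {t | ¬ ((toData d).1 ≤ t ∧ (∀ c ∈ (toData d).2.1, t < c) ∧
      A.IsPiece hA F (toData d).1 (toData d).2.1 (toData d).2.2)}) (by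
    intro T
    obtain ⟨t, ht⟩ := hcon (T.image toData)
    refine .of_forall fun n => ⟨t, fun d hd h => ?_⟩
    exact ht _ (Finset.mem_image_of_mem _ hd) h.1 h.2.1 h.2.2)
  -- A point `a` of `D` lies in `[a, s a)`, a one-point interval on which `F` is trivially constant,
  -- whereas `x` avoids all pieces over `D`.
  have hxD : ∀ b, ((((fun n => (x n : Γ)) : ℕ → Γ) : Ultrapower Γ), b) ∉ diag D := by
    intro b hb
    obtain ⟨a, ha, h⟩ := mem_diag.1 hb
    have h1 : ∀ᶠ n in hyperfilter ℕ, (x n : Γ) = a := Germ.coe_eq.1 (Prod.mk.inj h).1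
    obtain ⟨m, hm⟩ := h1.exists
    subst hm
    obtain ⟨n, hn1, hn2⟩ := (h1.and (hx (⟨x m, ha⟩,
      some ⟨⟨O.s (x m), O.s_mem _⟩, hsD _ ha⟩, .inr ⟨F (x m), hFD _ ha⟩))).exists
    have hnm : x n = x m := Subtype.ext hn1
    refine hn2 ⟨hnm.ge, ?_, ?_⟩
    · rintro _ ⟨⟩
      rw [hnm]
      exact O.lt_s _ (x m).2
    · intro y hy1 hy2
      have h2 : (y : Γ) < O.s (x m) := hy2 _ rfl
      have h3 : y = x m := by
        refine le_antisymm (not_lt.1 fun h4 => ?_) hy1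
        exact absurd h2 (not_lt.2 (O.s_le _ _ (x m).2 y.2 h4))
      rw [h3]
      rfl
  obtain ⟨f, hf, hfx⟩ := exists_eventually_eq_pieceVal hφ hSD hG hxD
  refine not_eventually_eq_pieceVal hφ hSD hG hxD hf ?_ hfx
  intro lo hlo hi hhi
  have h1 : ∃ f' : ℤ ⊕ B, f'.map id Subtype.val = f := by
    rcases f with l | c
    · exact ⟨.inl l, rfl⟩
    · exact ⟨.inr ⟨c, hf c rfl⟩, rfl⟩
  have h2 : ∃ hi' : Option B, hi'.map Subtype.val = hi := by
    rcases hi with _ | c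
    · exact ⟨none, rfl⟩
    · exact ⟨some ⟨c, hhi c rfl⟩, rfl⟩
  obtain ⟨f', rfl⟩ := h1
  obtain ⟨hi', rfl⟩ := h2
  exact hx (⟨lo, hlo⟩, hi', f')

end AsymptoticCouple


/-! ### From a finite cover by pieces to a partition. -/

theorem mainTheorem6 {Γ : Type*} [AddCommGroup Γ] [LinearOrder Γ] [IsOrderedAddMonoid Γ]
    (A : AsymptoticCouple Γ) (hA : A.IsTlogModel) (F : A.Psi → A.Psi)
    (hF : A.IsDefinableFun hA F) :
    ∃ (n : ℕ) (α : Fin (n + 1) → WithTop Γ),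
      StrictMono α ∧
      (∀ k, α k ∈ A.PsiTop) ∧
      α 0 = ((A.succ hA.integration 0 : Γ) : WithTop Γ) ∧
      α (Fin.last n) = ⊤ ∧
      ∀ k : Fin n,
        (∃ c : A.Psi, ∀ x : A.Psi,
          α k.castSucc ≤ ((x : Γ) : WithTop Γ) → ((x : Γ) : WithTop Γ) < α k.succ → F x = c) ∨
        (∃ l : ℤ, ∀ x : A.Psi,
          α k.castSucc ≤ ((x : Γ) : WithTop Γ) → ((x : Γ) : WithTop Γ) < α k.succ →
            ((F x : Γ) : WithTop Γ) = A.sPow hA l ((x : Γ) : WithTop Γ)) := by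
  classical
  let := ratModuleOfDivisible hA.divisible
  obtain ⟨T, hT⟩ := AsymptoticCouple.exists_finite_pieces hF
  let top : Option A.Psi → WithTop Γ := fun c => c.elim ⊤ fun c => ((c : Γ) : WithTop Γ)
  -- Besides `s0` and `⊤` only right ends of pieces are needed as break points, since each interval
  -- uses a piece that contains its left end.
  let E : Finset (WithTop Γ) := insert ⊤ (insert ((A.succ hA.integration 0 : Γ) : WithTop Γ)
    (T.image fun d => top d.2.1))
  have hEP : ∀ e ∈ E, e ∈ A.PsiTop := by
    intro e he
    rcases Finset.mem_insert.1 he with rfl | he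
    · exact .inl rfl
    rcases Finset.mem_insert.1 he with rfl | he
    · exact .inr ⟨_, hA.psi_least.1, rfl⟩
    obtain ⟨d, -, rfl⟩ := Finset.mem_image.1 he
    rcases hd : d.2.1 with _ | c
    · exact .inl rfl
    · exact .inr ⟨c, c.2, rfl⟩
  have hmin : ∀ e ∈ E, ((A.succ hA.integration 0 : Γ) : WithTop Γ) ≤ e := by
    intro e he
    rcases hEP e he with rfl | ⟨c, hc, rfl⟩
    · exact le_top
    · exact WithTop.coe_le_coe.2 (hA.psi_least.2 hc)
  have htop : ⊤ ∈ E := Finset.mem_insert_self _ _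
  have hs0 : ((A.succ hA.integration 0 : Γ) : WithTop Γ) ∈ E :=
    Finset.mem_insert_of_mem (Finset.mem_insert_self _ _)
  obtain ⟨n, hn⟩ : ∃ n, E.card = n + 1 :=
    Nat.exists_eq_succ_of_ne_zero (Finset.card_ne_zero_of_mem htop)
  have hα : ∀ e ∈ E, ∃ i, E.orderEmbOfFin hn i = e := by
    intro e he
    have : e ∈ Set.range (E.orderEmbOfFin hn) := by rwa [Finset.range_orderEmbOfFin]
    exact this
  refine ⟨n, E.orderEmbOfFin hn, (E.orderEmbOfFin hn).strictMono,
    fun k => hEP _ (Finset.orderEmbOfFin_mem _ _ _), ?_, ?_, ?_⟩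
  · obtain ⟨i, hi⟩ := hα _ hs0
    refine le_antisymm ?_ (hmin _ (Finset.orderEmbOfFin_mem _ _ _))
    rw [← hi]
    exact (E.orderEmbOfFin hn).monotone (Fin.zero_le i)
  · obtain ⟨i, hi⟩ := hα _ htop
    refine top_unique ?_
    rw [← hi]
    exact (E.orderEmbOfFin hn).monotone (Fin.le_last i)
  · intro k
    have hlt : E.orderEmbOfFin hn k.castSucc < E.orderEmbOfFin hn k.succ :=
      (E.orderEmbOfFin hn).strictMono k.castSucc_lt_succ
    obtain ⟨x₀, hx₀⟩ : ∃ x₀ : A.Psi, ((x₀ : Γ) : WithTop Γ) = E.orderEmbOfFin hn k.castSucc := by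
      rcases hEP _ (Finset.orderEmbOfFin_mem E hn k.castSucc) with h | ⟨c, hc, h⟩
      · exact absurd (h ▸ hlt) not_top_lt
      · exact ⟨⟨c, hc⟩, h⟩
    obtain ⟨d, hd, hlo, hhi, hpiece⟩ := hT x₀
    -- The right end of the chosen piece is a break point beyond `x₀`, hence not before the next
    -- one.
    have hle : E.orderEmbOfFin hn k.succ ≤ top d.2.1 := by
      obtain ⟨i, hi⟩ := hα (top d.2.1) (Finset.mem_insert_of_mem (Finset.mem_insert_of_mem
        (Finset.mem_image_of_mem (fun d => top d.2.1) hd)))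
      rw [← hi]
      refine (E.orderEmbOfFin hn).monotone (Fin.castSucc_lt_iff_succ_le.1
        ((E.orderEmbOfFin hn).lt_iff_lt.1 ?_))
      rw [hi, ← hx₀]
      rcases hc : d.2.1 with _ | c
      · exact WithTop.coe_lt_top _
      · exact WithTop.coe_lt_coe.2 (hhi c hc)
    have key : ∀ x : A.Psi, E.orderEmbOfFin hn k.castSucc ≤ ((x : Γ) : WithTop Γ) →
        ((x : Γ) : WithTop Γ) < E.orderEmbOfFin hn k.succ →
        ((F x : Γ) : WithTop Γ) = A.pieceVal hA d.2.2 ((x : Γ) : WithTop Γ) := by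
      intro x hx1 hx2
      refine hpiece x (hlo.trans ?_) fun c hc => ?_
      · rw [← hx₀] at hx1
        have h : (x₀ : Γ) ≤ x := WithTop.coe_le_coe.1 hx1
        exact h
      · have h := hx2.trans_le hle
        rw [Option.mem_def.1 hc] at h
        have h' : (x : Γ) < c := WithTop.coe_lt_coe.1 h
        exact h'
    rcases hd2 : d.2.2 with l | c
    · exact .inr ⟨l, fun x hx1 hx2 => by rw [key x hx1 hx2, hd2]; rfl⟩
    · refine .inl ⟨c, fun x hx1 hx2 => ?_⟩
      have h := key x hx1 hx2
      rw [hd2] at h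
      exact Subtype.ext (WithTop.coe_injective h)
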